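/- Let $\Omega\subset\mathbb R^2$ be a bounded convex open set, and let $\mathcal T_h$ be a (finite, conforming) triangulation of $\overline\Omega$. Let $\mu,\lambda>0$; for a vector field $\mathbf u=(u_1,u_2)$ put $\varepsilon(\mathbf u)=\frac12(\nabla\mathbf u+(\nabla\mathbf u)^{\top})$ and $\sigma(\mathbf u)=2\mu\,\varepsilon(\mathbf u)+\lambda\,\mathrm{tr}(\varepsilon(\mathbf u))\,I$. Let $B_h^3$ be the space of all $v\in L^2(\Omega)$ such that $v|_T$ is a polynomial of degree at most $3$ for every $T\in\mathcal T_h$, $v$ is continuous at all vertices, and, for every interior edge $e$ and every $p_e\in P_1(e)$, $\int_e[\![v]\!]\,ds=0$ and $\int_e p_e[\![\partial_n v]\!]\,ds=0$, where $[\![\cdot]\!]$ is the jump across $e$. Let $B_{h0}^3$ be the space of all $v\in B_h^3$ such that $v(a)=0$ at every boundary vertex $a$, and, for every boundary edge $e$ and every $p_e\in P_1(e)$, $\int_e v\,ds=0$ and $\int_e p_e\,\partial_n v\,ds=0$. For $\mathbf w_h\in(B_{h0}^3)^2$ define $$\|\mathbf w_h\|_h=\Big(\sum_{T\in\mathcal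 T_h}\int_T|\nabla\cdot\sigma(\mathbf w_h)|^2\,dx\Big)^{1/2}.$$ Let $\Delta_h$ and $\nabla_h^2$ be the elementwise Laplacian and Hessian (applied to each component), and $\|\cdot\|$ the $L^2(\Omega)$ norm. Then: 1. $\|\cdot\|_h$ is a norm on $(B_{h0}^3)^2$. 2. For all $\mathbf w_h\in(B_{h0}^3)^2$, $\ \|\mathbf w_h\|_h^2\ \ge\ \mu^2\|\Delta_h\mathbf w_h\|^2=\mu^2\|\nabla_h^2\mathbf w_h\|^2$. 3. The discrete bi-elastic source problem is well-posed: there is a constant $C\ge 0$ (depending only on $\Omega$, $\mathcal T_h$, $\mu$, $\lambda$) such that for every measurable $\beta$ on $\Omega$ with $0<\beta_{\min}\le\beta\le\beta_{\max}$, the form $$A_{\beta,h}(\mathbf w_h,\boldsymbol\varphi_h)=\sum_{T\in\mathcal T_h}\int_T\beta\,(\nabla\cdot\sigma(\mathbf w_h))\cdot(\nabla\cdot\sigma(\boldsymbol\varphi_h))\,dx$$ satisfies $A_{\beta,h}(\mathbf w_h,\mathbf w_h)\ge\beta_{\min}\|\mathbf w_h\|_h^2$ and $|A_{\beta,h}(\mathbf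 w_h,\boldsymbol\varphi_h)|\le\beta_{\max}\|\mathbf w_h\|_h\|\boldsymbol\varphi_h\|_h$ on $(B_{h0}^3)^2$, and for every $\mathbf f\in L^2(\Omega)^2$ there is exactly one $\mathbf w_h\in(B_{h0}^3)^2$ with $A_{\beta,h}(\mathbf w_h,\boldsymbol\varphi_h)=\int_\Omega\mathbf f\cdot\boldsymbol\varphi_h\,dx$ for all $\boldsymbol\varphi_h\in(B_{h0}^3)^2$; moreover $\|\mathbf w_h\|_h\le \frac{C}{\beta_{\min}}\|\mathbf f\|$. -/

import Mathlib

open MeasureTheory MvPolynomial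

noncomputable section

namespace BiElastic

/-- The Euclidean plane. -/
abbrev Plane : Type := EuclideanSpace ℝ (Fin 2)

/-- Real polynomials in the two coordinates `x₁, x₂`. -/
abbrev Poly : Type := MvPolynomial (Fin 2) ℝ

/-- The value of a polynomial at a point of the plane. -/
def evalAt (x : Plane) (p : Poly) : ℝ := MvPolynomial.eval (fun i => x i) p

/-- A (conforming) triangulation of `Ω`: a finite simplicial complex of nondegenerate simplices whose
union is the closure of `Ω`. -/
structure Mesh (Ω : Set Plane) where
  /-- the complex of triangles, edges and vertices -/
  complex : Geometry.SimplicialComplex ℝ Plane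
  finite_faces : complex.faces.Finite
  space_eq : complex.space = closure Ω

namespace Mesh

variable {Ω : Set Plane} (M : Mesh Ω)

/-- The triangles of the mesh, given by their vertices. -/
def triangles : Finset (Finset Plane) :=
  M.finite_faces.toFinset.filter (fun T => T.card = 3)

/-- The set of edges, given by their end points. -/
def edges : Set (Finset Plane) := {e | e ∈ M.complex.faces ∧ e.card = 2}

/-- The edges that lie on the boundary of `Ω`. -/
def boundaryEdges : Set (Finset Plane) :=
  {e | e ∈ M.edges ∧ convexHull ℝ (e : Set Plane) ⊆ frontier Ω}

/-- The other edges. -/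
def interiorEdges : Set (Finset Plane) :=
  {e | e ∈ M.edges ∧ ¬ convexHull ℝ (e : Set Plane) ⊆ frontier Ω}

end Mesh

/-- The closed triangle spanned by the three points of `T`. -/
def region (T : Finset Plane) : Set Plane := convexHull ℝ (T : Set Plane)

/-- The integral `∫_e p ds` with respect to arc length along the segment `e` from `a` to `b`. -/
def edgeIntegral (a b : Plane) (p : Poly) : ℝ :=
  dist a b * ∫ t in (0 : ℝ)..1, evalAt (AffineMap.lineMap a b t) p

/-- A unit normal of the segment from `a` to `b` (for `a ≠ b`). -/
def unitNormal (a b : Plane) : Fin 2 → ℝ :=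
  ![(b 1 - a 1) / dist a b, -(b 0 - a 0) / dist a b]

/-- The derivative of a polynomial in the direction of the unit normal of the segment from `a` to `b`. -/
def normalDeriv (a b : Plane) : Poly →ₗ[ℝ] Poly :=
  ∑ i : Fin 2, unitNormal a b i • (pderiv i : Derivation ℝ Poly Poly).toLinearMap

theorem continuous_evalAt (p : Poly) : Continuous (fun x : Plane => evalAt x p) := by
  unfold evalAt
  exact (MvPolynomial.continuous_eval p).comp (by fun_prop)

theorem edgeIntegral_add (a b : Plane) (p q : Poly) :
    edgeIntegral a b (p + q) = edgeIntegral a b p + edgeIntegral a b q := by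
  have h : ∀ r : Poly, IntervalIntegrable
      (fun t : ℝ => evalAt (AffineMap.lineMap a b t) r) volume 0 1 := fun r =>
    ((continuous_evalAt r).comp AffineMap.lineMap_continuous).intervalIntegrable 0 1
  rw [edgeIntegral, edgeIntegral, edgeIntegral, ← mul_add,
    ← intervalIntegral.integral_add (h p) (h q)]
  simp [evalAt]

theorem edgeIntegral_smul (a b : Plane) (c : ℝ) (p : Poly) :
    edgeIntegral a b (c • p) = c * edgeIntegral a b p := by
  simp only [edgeIntegral, evalAt, MvPolynomial.smul_eval, intervalIntegral.integral_const_mul]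
  ring

theorem edgeIntegral_zero (a b : Plane) : edgeIntegral a b 0 = 0 := by
  simp [edgeIntegral, evalAt]

/-- Piecewise polynomial functions on the mesh, as families `(v|_T)_T`. As triangles have interior points
and meet only in null sets, such a family is the same as a function in `L²(Ω)` (up to equality almost
everywhere) which agrees with a polynomial on each triangle. -/
abbrev Broken {Ω : Set Plane} (M : Mesh Ω) : Type := M.triangles → Poly

/-- The function on the plane given by a piecewise polynomial (set to zero on all edges). -/
def Broken.toFun {Ω : Set Plane} {M : Mesh Ω} (v : Broken M) (x : Plane) : ℝ :=
  ∑ T : M.triangles, (interior (region T.1)).indicator (fun y => evalAt y (v T)) x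

/-- The space `B³_h`: piecewise cubic functions that are continuous at the vertices, whose jumps have
mean zero over each interior edge, and whose normal derivatives have jumps that are orthogonal to the
affine functions on each interior edge. -/
def B3 {Ω : Set Plane} (M : Mesh Ω) : Submodule ℝ (Broken M) where
  carrier := {v |
    (∀ T, (v T).totalDegree ≤ 3) ∧
    (∀ T T' : M.triangles, ∀ a, a ∈ T.1 → a ∈ T'.1 → evalAt a (v T) = evalAt a (v T')) ∧
    (∀ e ∈ M.interiorEdges, ∀ T T' : M.triangles, e ⊆ T.1 → e ⊆ T'.1 →
      ∀ a ∈ e, ∀ b ∈ e, a ≠ b →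
        edgeIntegral a b (v T - v T') = 0 ∧
        ∀ p : Poly, p.totalDegree ≤ 1 →
          edgeIntegral a b (p * (normalDeriv a b (v T) - normalDeriv a b (v T'))) = 0)}
  zero_mem' := by
    refine ⟨by simp, by simp, ?_⟩
    intro e _ T T' _ _ a _ b _ _
    simp [edgeIntegral_zero]
  add_mem' := by
    rintro v w ⟨hv1, hv2, hv3⟩ ⟨hw1, hw2, hw3⟩
    refine ⟨fun T => (totalDegree_add _ _).trans (max_le (hv1 T) (hw1 T)), ?_, ?_⟩
    · intro T T' a h h'
      have h1 := hv2 T T' a h h'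
      have h2 := hw2 T T' a h h'
      simp only [evalAt, Pi.add_apply, map_add] at *
      rw [h1, h2]
    · intro e he T T' h h' a ha b hb hab
      obtain ⟨v1, v2⟩ := hv3 e he T T' h h' a ha b hb hab
      obtain ⟨w1, w2⟩ := hw3 e he T T' h h' a ha b hb hab
      refine ⟨?_, fun p hp => ?_⟩
      · rw [Pi.add_apply, Pi.add_apply, add_sub_add_comm, edgeIntegral_add, v1, w1, add_zero]
      · rw [Pi.add_apply, Pi.add_apply, map_add, map_add, add_sub_add_comm, mul_add,
          edgeIntegral_add, v2 p hp, w2 p hp, add_zero]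
  smul_mem' := by
    rintro c v ⟨hv1, hv2, hv3⟩
    refine ⟨fun T => (totalDegree_smul_le _ _).trans (hv1 T), ?_, ?_⟩
    · intro T T' a h h'
      have h1 := hv2 T T' a h h'
      simp only [evalAt, Pi.smul_apply, smul_eval] at *
      rw [h1]
    · intro e he T T' h h' a ha b hb hab
      obtain ⟨v1, v2⟩ := hv3 e he T T' h h' a ha b hb hab
      refine ⟨?_, fun p hp => ?_⟩
      · rw [Pi.smul_apply, Pi.smul_apply, ← smul_sub, edgeIntegral_smul, v1, mul_zero]
      · rw [Pi.smul_apply, Pi.smul_apply, map_smul, map_smul, ← smul_sub, mul_smul_comm,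
          edgeIntegral_smul, v2 p hp, mul_zero]

/-- The space `B³_{h0}`: functions in `B³_h` that vanish at the boundary vertices, have mean zero over
each boundary edge, and whose normal derivatives are orthogonal to the affine functions on each
boundary edge. -/
def B30 {Ω : Set Plane} (M : Mesh Ω) : Submodule ℝ (Broken M) where
  carrier := {v | v ∈ B3 M ∧
    (∀ T : M.triangles, ∀ a ∈ T.1, a ∈ frontier Ω → evalAt a (v T) = 0) ∧
    (∀ e ∈ M.boundaryEdges, ∀ T : M.triangles, e ⊆ T.1 → ∀ a ∈ e, ∀ b ∈ e, a ≠ b →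
      edgeIntegral a b (v T) = 0 ∧
      ∀ p : Poly, p.totalDegree ≤ 1 → edgeIntegral a b (p * normalDeriv a b (v T)) = 0)}
  zero_mem' := by
    refine ⟨zero_mem _, by simp [evalAt], ?_⟩
    intro e _ T _ a _ b _ _
    simp [edgeIntegral_zero]
  add_mem' := by
    rintro v w ⟨hv1, hv2, hv3⟩ ⟨hw1, hw2, hw3⟩
    refine ⟨add_mem hv1 hw1, ?_, ?_⟩
    · intro T a h h'
      have h1 := hv2 T a h h'
      have h2 := hw2 T a h h'
      simp only [evalAt, Pi.add_apply, map_add] at *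
      rw [h1, h2, add_zero]
    · intro e he T h a ha b hb hab
      obtain ⟨v1, v2⟩ := hv3 e he T h a ha b hb hab
      obtain ⟨w1, w2⟩ := hw3 e he T h a ha b hb hab
      refine ⟨?_, fun p hp => ?_⟩
      · rw [Pi.add_apply, edgeIntegral_add, v1, w1, add_zero]
      · rw [Pi.add_apply, map_add, mul_add, edgeIntegral_add, v2 p hp, w2 p hp, add_zero]
  smul_mem' := by
    rintro c v ⟨hv1, hv2, hv3⟩
    refine ⟨Submodule.smul_mem _ c hv1, ?_, ?_⟩
    · intro T a h h'
      have h1 := hv2 T a h h'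
      simp only [evalAt, Pi.smul_apply, smul_eval] at *
      rw [h1, mul_zero]
    · intro e he T h a ha b hb hab
      obtain ⟨v1, v2⟩ := hv3 e he T h a ha b hb hab
      refine ⟨?_, fun p hp => ?_⟩
      · rw [Pi.smul_apply, edgeIntegral_smul, v1, mul_zero]
      · rw [Pi.smul_apply, map_smul, mul_smul_comm, edgeIntegral_smul, v2 p hp, mul_zero]

/-- The space `(B³_{h0})²` of vector fields. -/
abbrev VB30 {Ω : Set Plane} (M : Mesh Ω) : Type := Fin 2 → B30 M

/-- The restriction of a vector field to the triangle `T`. -/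
def VB30.on {Ω : Set Plane} {M : Mesh Ω} (w : VB30 M) (T : M.triangles) : Fin 2 → Poly :=
  fun i => (w i).1 T

/-- The displacement gradient `(∂_j u_i)_{ij}`. -/
def dispGradient (u : Fin 2 → Poly) : Matrix (Fin 2) (Fin 2) Poly :=
  Matrix.of fun i j => pderiv j (u i)

/-- The strain tensor `ε(u) = (∇u + (∇u)ᵀ) / 2`. -/
def strain (u : Fin 2 → Poly) : Matrix (Fin 2) (Fin 2) Poly :=
  (1 / 2 : ℝ) • (dispGradient u + (dispGradient u).transpose)

/-- The stress tensor `σ(u) = 2μ ε(u) + lam tr(ε(u)) I`. -/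
def stress (μ lam : ℝ) (u : Fin 2 → Poly) : Matrix (Fin 2) (Fin 2) Poly :=
  (2 * μ) • strain u + lam • ((strain u).trace • (1 : Matrix (Fin 2) (Fin 2) Poly))

/-- The row-wise divergence `∇·σ(u)` of the stress tensor. -/
def divStress (μ lam : ℝ) (u : Fin 2 → Poly) : Fin 2 → Poly :=
  fun i => ∑ j, pderiv j (stress μ lam u i j)

/-- The Laplacian of a polynomial. -/
def laplacian (p : Poly) : Poly := ∑ j : Fin 2, pderiv j (pderiv j p)

/-- The broken energy norm `‖w‖_h = (∑_T ∫_T |∇·σ(w)|²)^{1/2}`. -/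
def energyNorm {Ω : Set Plane} {M : Mesh Ω} (μ lam : ℝ) (w : VB30 M) : ℝ :=
  Real.sqrt (∑ T : M.triangles, ∫ x in region T.1,
    ∑ i, evalAt x (divStress μ lam (w.on T) i) ^ 2)

/-- `‖Δ_h w‖`, where `Δ_h` is the elementwise Laplacian. -/
def laplaceNorm {Ω : Set Plane} {M : Mesh Ω} (w : VB30 M) : ℝ :=
  Real.sqrt (∑ T : M.triangles, ∫ x in region T.1,
    ∑ i, evalAt x (laplacian (w.on T i)) ^ 2)

/-- `‖∇_h² w‖`, where `∇_h²` is the elementwise Hessian. -/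
def hessianNorm {Ω : Set Plane} {M : Mesh Ω} (w : VB30 M) : ℝ :=
  Real.sqrt (∑ T : M.triangles, ∫ x in region T.1,
    ∑ i, ∑ j, ∑ k, evalAt x (pderiv j (pderiv k (w.on T i))) ^ 2)

/-- The discrete bilinear form `A_{β,h}(w, φ) = ∑_T ∫_T β ∇·σ(w) · ∇·σ(φ)`. -/
def energyForm {Ω : Set Plane} {M : Mesh Ω} (μ lam : ℝ) (β : Plane → ℝ) (w φ : VB30 M) : ℝ :=
  ∑ T : M.triangles, ∫ x in region T.1,
    β x * ∑ i, evalAt x (divStress μ lam (w.on T) i) * evalAt x (divStress μ lam (φ.on T) i)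

/-- The load `(f, φ) = ∫_Ω f · φ`. -/
def load {Ω : Set Plane} {M : Mesh Ω} (f : Plane → Fin 2 → ℝ) (φ : VB30 M) : ℝ :=
  ∫ x in Ω, ∑ i, f x i * Broken.toFun (φ i).1 x

/-- The norm of `f` in `L²(Ω)²`. -/
def l2Norm (Ω : Set Plane) (f : Plane → Fin 2 → ℝ) : ℝ :=
  Real.sqrt (∫ x in Ω, ∑ i, f x i ^ 2)

/-- `w` solves the discrete bi-elastic source problem with coefficient `β` and right-hand side `f`. -/
def IsDiscreteSolution {Ω : Set Plane} {M : Mesh Ω} (μ lam : ℝ) (β : Plane → ℝ)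
    (f : Plane → Fin 2 → ℝ) (w : VB30 M) : Prop :=
  ∀ φ : VB30 M, energyForm μ lam β w φ = load f φ

end BiElastic

end

/-!
The form `A_{β,h}` is coercive and bounded for the energy norm because `β` is bounded from below and
above, so that everything rests on the two facts that the energy norm dominates `μ ‖∇²_h w‖`, and that
a function in `B³_{h0}` with vanishing elementwise Hessian is zero.

With `p = div w` and `q = ∂₂w₁ - ∂₁w₂` one has `∇·σ(w) = μ Δw + (μ + λ) ∇p` and
`Δw · ∇p = |∇p|² + J(p, q)`, where `J(f, g) = ∂₁f ∂₂g - ∂₂f ∂₁g` is the Jacobian determinant, and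
`|∇²u|² = (Δu)² - 2 J(∂₁u, ∂₂u)`. All functions to which `J` is applied here are combinations of first
partial derivatives of functions in `B³_{h0}`, and these are nonconforming quadratic functions of
Fortin–Soulie type: their jumps across the interior edges and their boundary traces are orthogonal to
the affine functions, that is, multiples of the quadratic Legendre polynomial of the edge
(`isLegendre_pderiv`, `pderiv_mem_fortinSoulie`). The key fact is that `∑_T ∫_T J(f, g) = 0` for all
such `f` and `g` (`Mesh.sum_setIntegral_jacobian_eq_zero`), as for functions in `H¹₀`.

By Green's formula, `∫_T J(f, g)` is the sum of `∫ f dg` over the oriented edges of `T`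
(`setIntegral_jacobian`). The contributions of the two triangles at an interior edge from `a` to `b`
do not cancel: what remains is `d (f(b) - f(a))`, where `d Λ` is the jump of `g`, with the Legendre
polynomial `Λ` (equal to `1` at `a` and `b`). If `d` is a difference `C_T - C_{T'}` of constants that
belong to the triangles, then the remainders can be redistributed to the triangles, where they
telescope. Such constants exist (`Mesh.exists_constants`): the function
`Φ(z) = ∑_T ∑_{(a,b)} c_{T,ab} log ((b - z) / (a - z))`, with the Legendre coefficients `c_{T,ab}` of `g`
on the oriented edges of `T`, has derivative zero off the edges, and it jumps by `2πi d` across an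
edge, so that `C_T = Im Φ|_T / 2π` will do.

Cancellation along the edges (`Mesh.sum_leftEdges_eq_zero`) also gives definiteness: the area of a
triangle is a sum over its edges, whence a piecewise constant function without jumps and with zero
boundary values vanishes (`Mesh.eq_zero_of_no_jumps`). This is applied to the gradient and then to the
function itself. It rests on the fact that an edge not contained in the boundary has exactly one
triangle on each side (`Mesh.isLeft_unique`, `Mesh.exists_isLeft`).
-/

noncomputable section

namespace BiElastic

open Filter Topology
open scoped Classical

/-! ### Polynomials along lines -/

section evalAt

variable (x : Plane) (p q : Poly)

@[simp] theorem evalAt_add : evalAt x (p + q) = evalAt x p + evalAt x q := by simp [evalAt]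

@[simp] theorem evalAt_sub : evalAt x (p - q) = evalAt x p - evalAt x q := by simp [evalAt]

@[simp] theorem evalAt_mul : evalAt x (p * q) = evalAt x p * evalAt x q := by simp [evalAt]

@[simp] theorem evalAt_smul (c : ℝ) : evalAt x (c • p) = c * evalAt x p := by simp [evalAt]

@[simp] theorem evalAt_zero : evalAt x 0 = 0 := by simp [evalAt]

@[simp] theorem evalAt_one : evalAt x 1 = 1 := by simp [evalAt]

@[simp] theorem evalAt_C (c : ℝ) : evalAt x (C c) = c := by simp [evalAt]

@[simp] theorem evalAt_X (i : Fin 2) : evalAt x (X i) = x i := by simp [evalAt]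

end evalAt

/-- The derivative of a polynomial in the direction of the vector `v`. -/
def dirDeriv (v : Plane) : Derivation ℝ Poly Poly :=
  v 0 • pderiv 0 + v 1 • pderiv 1

theorem dirDeriv_apply (v : Plane) (p : Poly) :
    dirDeriv v p = v 0 • pderiv 0 p + v 1 • pderiv 1 p := rfl

theorem hasDerivAt_evalAt_line (x v : Plane) (p : Poly) (t : ℝ) :
    HasDerivAt (fun s : ℝ => evalAt (x + s • v) p) (evalAt (x + t • v) (dirDeriv v p)) t := by
  induction p using MvPolynomial.induction_on with
  | C c =>
    have h : dirDeriv v (C c) = 0 := by simp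
    simpa [h] using hasDerivAt_const t c
  | add p q hp hq => simpa using hp.fun_add hq
  | mul_X p i hp =>
    have hX : HasDerivAt (fun s : ℝ => x i + s * v i) (v i) t := by
      simpa using ((hasDerivAt_id t).mul_const (v i)).const_add (x i)
    have hD : evalAt (x + t • v) (dirDeriv v (X i)) = v i := by
      fin_cases i <;> simp [dirDeriv_apply, pderiv_X]
    have h := hp.mul hX
    have e : (fun s : ℝ => evalAt (x + s • v) (p * X i)) =
        (fun s : ℝ => evalAt (x + s • v) p) * fun s : ℝ => x i + s * v i := by
      ext s; simp
    rw [e]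
    refine h.congr_deriv ?_
    rw [Derivation.leibniz, smul_eq_mul, smul_eq_mul, evalAt_add, evalAt_mul, evalAt_mul, hD]
    simp
    ring

theorem lineMap_eq (a b : Plane) (t : ℝ) : AffineMap.lineMap a b t = a + t • (b - a) := by
  rw [AffineMap.lineMap_apply_module', add_comm]

theorem hasDerivAt_evalAt_lineMap (a b : Plane) (p : Poly) (t : ℝ) :
    HasDerivAt (fun s : ℝ => evalAt (AffineMap.lineMap a b s) p)
      (evalAt (AffineMap.lineMap a b t) (dirDeriv (b - a) p)) t := by
  simpa only [lineMap_eq] using hasDerivAt_evalAt_line a (b - a) p t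

theorem continuous_evalAt_lineMap (a b : Plane) (p : Poly) :
    Continuous fun t : ℝ => evalAt (AffineMap.lineMap a b t) p :=
  (continuous_evalAt p).comp AffineMap.lineMap_continuous

/-- The restriction of a polynomial to a line is a polynomial of at most the same degree. -/
theorem exists_trace (a b : Plane) {p : Poly} {n : ℕ} (hp : p.totalDegree ≤ n) :
    ∃ q : Polynomial ℝ, q.natDegree ≤ n ∧
      (∀ t : ℝ, evalAt (AffineMap.lineMap a b t) p = q.eval t) ∧
      ∀ t : ℝ, evalAt (AffineMap.lineMap a b t) (dirDeriv (b - a) p) =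
        (Polynomial.derivative q).eval t := by
  let c : Fin 2 → Polynomial ℝ := fun i =>
    Polynomial.C (a i) + Polynomial.C (b i - a i) * Polynomial.X
  have h : ∀ t : ℝ, evalAt (AffineMap.lineMap a b t) p = (aeval c p).eval t := by
    intro t
    rw [← Polynomial.coe_aeval_eq_eval, comp_aeval_apply, evalAt, ← MvPolynomial.coe_aeval_eq_eval]
    refine congrArg (fun y => aeval y p) (funext fun i => ?_)
    simp [c, lineMap_eq, mul_comm t]
  refine ⟨aeval c p, ?_, h, fun t => ?_⟩
  · refine (aeval_natDegree_le p hp c (n := 1) fun i => ?_).trans (by simp)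
    simp only [c]
    compute_degree
  · refine (hasDerivAt_evalAt_lineMap a b p t).unique ?_
    simp only [h]
    exact Polynomial.hasDerivAt _ t

/-- The area form: twice the signed area of the triangle `abc`. -/
def cross (a b c : Plane) : ℝ := (b 0 - a 0) * (c 1 - a 1) - (b 1 - a 1) * (c 0 - a 0)

/-- The Jacobian determinant of the pair `(f, g)`. -/
def jacobian (f g : Poly) : Poly := pderiv 0 f * pderiv 1 g - pderiv 1 f * pderiv 0 g

/-- The line integral `∫ f dg` along the segment from `a` to `b`. -/
def lineForm (f g : Poly) (a b : Plane) : ℝ :=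
  ∫ t in (0 : ℝ)..1, evalAt (AffineMap.lineMap a b t) (f * dirDeriv (b - a) g)

theorem pderiv_comm (i j : Fin 2) (p : Poly) : pderiv i (pderiv j p) = pderiv j (pderiv i p) := by
  have h : ⁅(pderiv i : Derivation ℝ Poly Poly), (pderiv j : Derivation ℝ Poly Poly)⁆ = 0 := by
    refine MvPolynomial.derivation_ext fun k => ?_
    rw [Derivation.commutator_apply, pderiv_X, pderiv_X]
    have h (l m : Fin 2) : pderiv l (if m = k then (1 : Poly) else 0) = 0 := by
      split_ifs <;> simp
    simp only [Pi.single_apply, Derivation.zero_apply, eq_comm (a := k), h, sub_zero]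
  have h' := congrArg (fun D => D p) h
  simpa [Derivation.commutator_apply, sub_eq_zero] using h'

theorem totalDegree_pderiv_le (i : Fin 2) {p : Poly} {n : ℕ} (hp : p.totalDegree ≤ n + 1) :
    (pderiv i p).totalDegree ≤ n := by
  rw [p.as_sum, map_sum]
  refine totalDegree_finsetSum_le fun s hs => ?_
  rw [pderiv_monomial]
  by_cases h : s i = 0
  · simp [h]
  · refine (totalDegree_monomial_le _ _).trans ?_
    have h1 : (s.sum fun _ e => e) ≤ n + 1 := (le_totalDegree hs).trans hp
    have h2 : s = (s - Finsupp.single i 1) + Finsupp.single i 1 := by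
      rw [tsub_add_cancel_of_le]
      simpa using Nat.one_le_iff_ne_zero.2 h
    rw [h2, Finsupp.sum_add_index' (by simp) (by simp)] at h1
    have h3 : ((s - Finsupp.single i 1).sum fun _ e => e) ≤ n := by simpa using h1
    exact h3

theorem dirDeriv_comm (u v : Plane) (p : Poly) :
    dirDeriv u (dirDeriv v p) = dirDeriv v (dirDeriv u p) := by
  simp only [dirDeriv_apply, map_add, Derivation.map_smul, pderiv_comm 1 0]
  module

/-- The Jacobian determinant in the basis `b - a, c - a`, in divergence form. -/
theorem cross_smul_jacobian (a b c : Plane) (f g : Poly) :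
    cross a b c • jacobian f g = dirDeriv (b - a) (f * dirDeriv (c - a) g) -
      dirDeriv (c - a) (f * dirDeriv (b - a) g) := by
  rw [Derivation.leibniz, Derivation.leibniz, dirDeriv_comm (b - a)]
  simp only [dirDeriv_apply, jacobian, cross, smul_eq_mul, MvPolynomial.smul_eq_C_mul]
  simp
  ring

/-! ### Green's formula on a triangle -/

/-- The reference triangle. -/
def refTriangle : Set (ℝ × ℝ) := {p | 0 ≤ p.1 ∧ 0 ≤ p.2 ∧ p.1 + p.2 ≤ 1}

theorem isCompact_refTriangle : IsCompact refTriangle := by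
  refine Metric.isCompact_of_isClosed_isBounded ?_ ?_
  · exact (isClosed_le continuous_const continuous_fst).inter
      ((isClosed_le continuous_const continuous_snd).inter
        (isClosed_le (continuous_fst.add continuous_snd) continuous_const))
  · refine (Metric.isBounded_Icc (0 : ℝ × ℝ) 1).subset ?_
    rintro ⟨x, y⟩ ⟨h1, h2, h3⟩
    simp only [Set.mem_Icc, Prod.le_def, Prod.fst_zero, Prod.snd_zero, Prod.fst_one, Prod.snd_one]
      at *
    constructor <;> constructor <;> linarith

theorem setIntegral_refTriangle {G : ℝ × ℝ → ℝ} (hG : Continuous G) :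
    ∫ p in refTriangle, G p = ∫ t in (0 : ℝ)..1, ∫ s in (0 : ℝ)..(1 - t), G (s, t) := by
  have hm : MeasurableSet refTriangle := isCompact_refTriangle.measurableSet
  have hi : Integrable (refTriangle.indicator G) (volume.prod volume) :=
    (integrable_indicator_iff hm).2 (hG.continuousOn.integrableOn_compact isCompact_refTriangle)
  rw [← integral_indicator hm, Measure.volume_eq_prod, integral_prod_symm _ hi,
    intervalIntegral.integral_of_le zero_le_one, ← integral_Icc_eq_integral_Ioc,
    ← integral_indicator measurableSet_Icc]
  congr 1
  ext t
  by_cases ht : t ∈ Set.Icc (0 : ℝ) 1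
  · rw [Set.indicator_of_mem ht, intervalIntegral.integral_of_le (by linarith [ht.2]),
      ← integral_Icc_eq_integral_Ioc, ← integral_indicator measurableSet_Icc]
    congr 1
    ext s
    have : (s, t) ∈ refTriangle ↔ s ∈ Set.Icc 0 (1 - t) := by
      simp only [refTriangle, Set.mem_ofPred_eq, Set.mem_Icc]
      constructor
      · rintro ⟨h1, -, h3⟩; exact ⟨h1, by linarith⟩
      · rintro ⟨h1, h3⟩; exact ⟨h1, ht.1, by linarith⟩
    simp only [Set.indicator, this]
  · rw [Set.indicator_of_notMem ht]
    refine (integral_congr_ae (Filter.Eventually.of_forall fun s => ?_)).trans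
      (integral_zero ℝ ℝ)
    refine Set.indicator_of_notMem (fun h => ht ?_) _
    exact ⟨h.2.1, by linarith [h.1, h.2.2]⟩

theorem setIntegral_refTriangle' {G : ℝ × ℝ → ℝ} (hG : Continuous G) :
    ∫ p in refTriangle, G p = ∫ s in (0 : ℝ)..1, ∫ t in (0 : ℝ)..(1 - s), G (s, t) := by
  refine Eq.trans ?_ (setIntegral_refTriangle (G := fun p => G p.swap) (by fun_prop))
  have h := (Measure.measurePreserving_swap (μ := (volume : Measure ℝ)) (ν := (volume : Measure ℝ)))
  rw [Measure.volume_eq_prod,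
    ← h.setIntegral_preimage_emb MeasurableEquiv.prodComm.measurableEmbedding]
  congr 2
  ext ⟨x, y⟩
  simp only [refTriangle, Set.mem_preimage, Set.mem_ofPred_eq, Prod.fst_swap, Prod.snd_swap]
  constructor <;> rintro ⟨h1, h2, h3⟩ <;> exact ⟨h2, h1, by linarith⟩

/-- The point of the plane with affine coordinates `p` in the frame `a; b - a, c - a`. -/
def frame (a b c : Plane) (p : ℝ × ℝ) : Plane := a + p.1 • (b - a) + p.2 • (c - a)

theorem continuous_frame (a b c : Plane) : Continuous (frame a b c) := by
  unfold frame; fun_prop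

theorem convexHull_triple (a b c : Plane) :
    convexHull ℝ {a, b, c} = frame a b c '' refTriangle := by
  apply Set.Subset.antisymm
  · refine convexHull_min ?_ ?_
    · rintro x (rfl | rfl | rfl)
      · exact ⟨(0, 0), by simp [refTriangle], by simp [frame]⟩
      · exact ⟨(1, 0), by simp [refTriangle], by simp [frame]⟩
      · exact ⟨(0, 1), by simp [refTriangle], by simp [frame]⟩
    · rintro _ ⟨⟨x, y⟩, ⟨h1, h2, h3⟩, rfl⟩ _ ⟨⟨z, w⟩, ⟨k1, k2, k3⟩, rfl⟩ s t hs ht hst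
      simp only at *
      refine ⟨(s * x + t * z, s * y + t * w), ⟨by positivity, by positivity, ?_⟩, ?_⟩
      · simp only
        nlinarith
      · simp only [frame]
        have : s = 1 - t := by linarith
        subst this
        module
  · rintro _ ⟨⟨x, y⟩, ⟨h1, h2, h3⟩, rfl⟩
    have h := (convex_convexHull ℝ {a, b, c}).sum_mem (t := Finset.univ)
      (w := ![1 - x - y, x, y]) (z := ![a, b, c]) ?_ ?_ ?_
    · convert h using 1
      simp only [frame, Fin.sum_univ_three, Matrix.cons_val]
      module
    · simp only at *
      intro i _
      fin_cases i <;> simp <;> linarith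
    · simp [Fin.sum_univ_three]
      ring
    · intro i _
      apply subset_convexHull
      fin_cases i <;> simp

/-- Change of variables from a positively oriented triangle to the reference triangle. -/
theorem setIntegral_triangle {a b c : Plane} (h : 0 < cross a b c) (F : Plane → ℝ) :
    ∫ x in convexHull ℝ {a, b, c}, F x =
      cross a b c * ∫ p in refTriangle, F (frame a b c p) := by
  let e : ℝ × ℝ ≃ᵐ Plane :=
    MeasurableEquiv.finTwoArrow.symm.trans (MeasurableEquiv.toLp 2 (Fin 2 → ℝ))
  have he : MeasurePreserving e volume volume :=
    ((volume_preserving_finTwoArrow ℝ).symm _).trans (PiLp.volume_preserving_toLp (Fin 2))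
  have hes (x : Plane) : e.symm x = (x 0, x 1) := rfl
  let u : Plane := b - a
  let v : Plane := c - a
  let L : ℝ × ℝ →L[ℝ] ℝ × ℝ :=
    ((u 0) • ContinuousLinearMap.fst ℝ ℝ ℝ + (v 0) • ContinuousLinearMap.snd ℝ ℝ ℝ).prod
      ((u 1) • ContinuousLinearMap.fst ℝ ℝ ℝ + (v 1) • ContinuousLinearMap.snd ℝ ℝ ℝ)
  have hdet : L.det = cross a b c := by
    rw [ContinuousLinearMap.det, ← LinearMap.det_toMatrix (Module.Basis.finTwoProd ℝ),
      Matrix.det_fin_two]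
    simp [LinearMap.toMatrix_apply, L, u, v, cross]
    ring
  let A : ℝ × ℝ → ℝ × ℝ := fun p => (a 0, a 1) + L p
  have hA (p : ℝ × ℝ) : e (A p) = frame a b c p := by
    apply e.symm.injective
    rw [e.symm_apply_apply, hes]
    simp [A, L, frame, u, v]
    constructor <;> ring
  have hinj : Function.Injective A := by
    rintro ⟨x, y⟩ ⟨z, w⟩ hxy
    simp only [A, L, u, v, Prod.mk.injEq, add_right_inj, ContinuousLinearMap.prod_apply,
      add_apply, smul_apply,
      ContinuousLinearMap.coe_fst', ContinuousLinearMap.coe_snd', smul_eq_mul,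
      PiLp.sub_apply] at hxy
    obtain ⟨h1, h2⟩ := hxy
    unfold cross at h
    have e1 : ((b 0 - a 0) * (c 1 - a 1) - (b 1 - a 1) * (c 0 - a 0)) * (x - z) = 0 := by
      linear_combination (c 1 - a 1) * h1 - (c 0 - a 0) * h2
    have e2 : ((b 0 - a 0) * (c 1 - a 1) - (b 1 - a 1) * (c 0 - a 0)) * (y - w) = 0 := by
      linear_combination (b 0 - a 0) * h2 - (b 1 - a 1) * h1
    rw [Prod.mk.injEq]
    exact ⟨sub_eq_zero.1 ((mul_eq_zero.1 e1).resolve_left h.ne'),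
      sub_eq_zero.1 ((mul_eq_zero.1 e2).resolve_left h.ne')⟩
  have himg : e ⁻¹' (convexHull ℝ {a, b, c}) = A '' refTriangle := by
    rw [convexHull_triple, ← funext hA, ← Function.comp_def e A, Set.image_comp,
      e.injective.preimage_image]
  rw [← he.setIntegral_preimage_emb e.measurableEmbedding, himg,
    integral_image_eq_integral_abs_det_fderiv_smul volume isCompact_refTriangle.measurableSet
      (f' := fun _ => L) (fun x _ => (L.hasFDerivAt.const_add _).hasFDerivWithinAt) hinj.injOn]
  simp only [hdet, smul_eq_mul, abs_of_pos h, integral_const_mul]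
  exact congrArg _ (integral_congr_ae (Filter.Eventually.of_forall fun p => congrArg F (hA p)))

/-- **Green's formula** for a pair of polynomials on a positively oriented triangle. -/
theorem setIntegral_jacobian {a b c : Plane} (h : 0 < cross a b c) (f g : Poly) :
    ∫ x in convexHull ℝ {a, b, c}, evalAt x (jacobian f g) =
      lineForm f g a b + lineForm f g b c + lineForm f g c a := by
  have hcont (p : Poly) : Continuous fun q => evalAt (frame a b c q) p :=
    (continuous_evalAt p).comp (continuous_frame a b c)
  have hint (p : Poly) : IntegrableOn (fun q => evalAt (frame a b c q) p) refTriangle :=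
    (hcont p).continuousOn.integrableOn_compact isCompact_refTriangle
  -- integrals of the derivatives along the two sides at `a`
  have hu (p : Poly) : ∫ q in refTriangle, evalAt (frame a b c q) (dirDeriv (b - a) p) =
      (∫ t in (0 : ℝ)..1, evalAt (AffineMap.lineMap b c t) p) -
        ∫ t in (0 : ℝ)..1, evalAt (AffineMap.lineMap a c t) p := by
    rw [setIntegral_refTriangle (hcont _), ← intervalIntegral.integral_sub
      ((continuous_evalAt_lineMap _ _ _).intervalIntegrable _ _)
      ((continuous_evalAt_lineMap _ _ _).intervalIntegrable _ _)]
    refine intervalIntegral.integral_congr fun t _ => ?_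
    have hd (s : ℝ) : frame a b c (s, t) = (a + t • (c - a)) + s • (b - a) := by
      simp only [frame]; module
    rw [intervalIntegral.integral_eq_sub_of_hasDerivAt
      (f := fun s => evalAt (frame a b c (s, t)) p)]
    · rw [hd, hd, lineMap_eq, lineMap_eq]
      congr 2 <;> module
    · intro s _
      simp only [hd]
      exact hasDerivAt_evalAt_line _ _ _ _
    · exact ((hcont _).comp (by fun_prop)).intervalIntegrable _ _
  have hv (p : Poly) : ∫ q in refTriangle, evalAt (frame a b c q) (dirDeriv (c - a) p) =
      (∫ t in (0 : ℝ)..1, evalAt (AffineMap.lineMap b c t) p) -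
        ∫ t in (0 : ℝ)..1, evalAt (AffineMap.lineMap a b t) p := by
    have hrev : ∫ t in (0 : ℝ)..1, evalAt (AffineMap.lineMap b c t) p =
        ∫ t in (0 : ℝ)..1, evalAt (AffineMap.lineMap c b t) p := by
      have := intervalIntegral.integral_comp_sub_left
        (fun t => evalAt (AffineMap.lineMap c b t) p) (a := 0) (b := 1) 1
      simpa [AffineMap.lineMap_apply_one_sub] using this
    rw [hrev, setIntegral_refTriangle' (hcont _), ← intervalIntegral.integral_sub
      ((continuous_evalAt_lineMap _ _ _).intervalIntegrable _ _)
      ((continuous_evalAt_lineMap _ _ _).intervalIntegrable _ _)]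
    refine intervalIntegral.integral_congr fun t _ => ?_
    have hd (s : ℝ) : frame a b c (t, s) = (a + t • (b - a)) + s • (c - a) := by
      simp only [frame]
    rw [intervalIntegral.integral_eq_sub_of_hasDerivAt
      (f := fun s => evalAt (frame a b c (t, s)) p)]
    · rw [hd, hd, lineMap_eq, lineMap_eq]
      congr 2 <;> module
    · intro s _
      simp only [hd]
      exact hasDerivAt_evalAt_line _ _ _ _
    · exact ((hcont _).comp (by fun_prop)).intervalIntegrable _ _
  rw [setIntegral_triangle h, ← integral_const_mul]
  simp_rw [← evalAt_smul, cross_smul_jacobian, evalAt_sub]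
  rw [integral_sub (hint _) (hint _), hu, hv]
  have hbc : lineForm f g b c =
      (∫ t in (0 : ℝ)..1, evalAt (AffineMap.lineMap b c t) (f * dirDeriv (c - a) g)) -
        ∫ t in (0 : ℝ)..1, evalAt (AffineMap.lineMap b c t) (f * dirDeriv (b - a) g) := by
    rw [lineForm, ← intervalIntegral.integral_sub
      ((continuous_evalAt_lineMap _ _ _).intervalIntegrable _ _)
      ((continuous_evalAt_lineMap _ _ _).intervalIntegrable _ _)]
    refine intervalIntegral.integral_congr fun t _ => ?_
    simp [dirDeriv_apply]
    ring
  have hca : lineForm f g c a =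
      -∫ t in (0 : ℝ)..1, evalAt (AffineMap.lineMap a c t) (f * dirDeriv (c - a) g) := by
    have := intervalIntegral.integral_comp_sub_left
      (fun t => evalAt (AffineMap.lineMap c a t) (f * dirDeriv (a - c) g)) (a := 0) (b := 1) 1
    rw [sub_self, sub_zero] at this
    rw [lineForm, ← this, ← intervalIntegral.integral_neg]
    refine intervalIntegral.integral_congr fun t _ => ?_
    simp [dirDeriv_apply, AffineMap.lineMap_apply_one_sub]
    ring
  rw [hbc, hca, lineForm]
  ring

/-! ### Polynomials on an edge -/

/-- The restriction to the line `ab` of a cubic polynomial and of its derivative along `b - a`. -/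
theorem exists_cubic_trace (a b : Plane) {p : Poly} (hp : p.totalDegree ≤ 3) :
    ∃ c₀ c₁ c₂ c₃ : ℝ,
      (∀ t : ℝ, evalAt (AffineMap.lineMap a b t) p = c₀ + c₁ * t + c₂ * t ^ 2 + c₃ * t ^ 3) ∧
      ∀ t : ℝ, evalAt (AffineMap.lineMap a b t) (dirDeriv (b - a) p) =
        c₁ + 2 * c₂ * t + 3 * c₃ * t ^ 2 := by
  obtain ⟨q, hq, h1, h2⟩ := exists_trace a b hp
  refine ⟨q.coeff 0, q.coeff 1, q.coeff 2, q.coeff 3, fun t => ?_, fun t => ?_⟩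
  · rw [h1, Polynomial.eval_eq_sum_range' (Nat.lt_succ_of_le hq)]
    simp [Finset.sum_range_succ]
  · rw [h2, Polynomial.eval_eq_sum_range' (n := 3) ?_]
    · simp only [Finset.sum_range_succ, Finset.sum_range_zero, Polynomial.coeff_derivative]
      push_cast
      ring
    · exact ((Polynomial.natDegree_derivative_le q).trans_lt (by omega))

/-- The restriction to the line `ab` of a quadratic polynomial and of its derivative along
`b - a`. -/
theorem exists_quadratic_trace (a b : Plane) {p : Poly} (hp : p.totalDegree ≤ 2) :
    ∃ c₀ c₁ c₂ : ℝ,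
      (∀ t : ℝ, evalAt (AffineMap.lineMap a b t) p = c₀ + c₁ * t + c₂ * t ^ 2) ∧
      ∀ t : ℝ, evalAt (AffineMap.lineMap a b t) (dirDeriv (b - a) p) = c₁ + 2 * c₂ * t := by
  obtain ⟨q, hq, h1, h2⟩ := exists_trace a b hp
  refine ⟨q.coeff 0, q.coeff 1, q.coeff 2, fun t => ?_, fun t => ?_⟩
  · rw [h1, Polynomial.eval_eq_sum_range' (Nat.lt_succ_of_le hq)]
    simp [Finset.sum_range_succ]
  · rw [h2, Polynomial.eval_eq_sum_range' (n := 2) ?_]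
    · simp only [Finset.sum_range_succ, Finset.sum_range_zero, Polynomial.coeff_derivative]
      push_cast
      ring
    · exact ((Polynomial.natDegree_derivative_le q).trans_lt (by omega))

theorem integral_cubic (c₀ c₁ c₂ c₃ : ℝ) :
    ∫ t in (0 : ℝ)..1, (c₀ + c₁ * t + c₂ * t ^ 2 + c₃ * t ^ 3) =
      c₀ + c₁ / 2 + c₂ / 3 + c₃ / 4 := by
  have hd (t : ℝ) : HasDerivAt (fun t : ℝ => c₀ * t + c₁ / 2 * t ^ 2 + c₂ / 3 * t ^ 3 +
      c₃ / 4 * t ^ 4) (c₀ + c₁ * t + c₂ * t ^ 2 + c₃ * t ^ 3) t := by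
    have h := ((((hasDerivAt_id t).const_mul c₀).fun_add ((hasDerivAt_pow 2 t).const_mul (c₁ / 2))).fun_add
      ((hasDerivAt_pow 3 t).const_mul (c₂ / 3))).fun_add ((hasDerivAt_pow 4 t).const_mul (c₃ / 4))
    refine h.congr_deriv ?_
    push_cast
    ring
  rw [intervalIntegral.integral_eq_sub_of_hasDerivAt (fun t _ => hd t)
    (Continuous.intervalIntegrable (by fun_prop) _ _)]
  ring

theorem lineMap_half (a b : Plane) : AffineMap.lineMap a b (1 / 2 : ℝ) = midpoint ℝ a b := by
  simp [midpoint]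

/-- For polynomials of degree two, `∫ f dg` along a segment is given by the values at the end points
and at the midpoint. -/
theorem lineForm_eq (a b : Plane) {f g : Poly} (hf : f.totalDegree ≤ 2) (hg : g.totalDegree ≤ 2) :
    lineForm f g a b =
      (-3 * evalAt a f * evalAt a g + 4 * evalAt a f * evalAt (midpoint ℝ a b) g
        - evalAt a f * evalAt b g - 4 * evalAt (midpoint ℝ a b) f * evalAt a g
        + 4 * evalAt (midpoint ℝ a b) f * evalAt b g + evalAt b f * evalAt a g
        - 4 * evalAt b f * evalAt (midpoint ℝ a b) g + 3 * evalAt b f * evalAt b g) / 6 := by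
  obtain ⟨f₀, f₁, f₂, hF, -⟩ := exists_quadratic_trace a b hf
  obtain ⟨g₀, g₁, g₂, hG, hG'⟩ := exists_quadratic_trace a b hg
  have ef := And.intro (hF 0) (And.intro (hF 1) (hF (1 / 2)))
  have eg := And.intro (hG 0) (And.intro (hG 1) (hG (1 / 2)))
  rw [AffineMap.lineMap_apply_zero, AffineMap.lineMap_apply_one, lineMap_half] at ef eg
  rw [ef.1, ef.2.1, ef.2.2, eg.1, eg.2.1, eg.2.2, lineForm]
  have : ∀ t : ℝ, evalAt (AffineMap.lineMap a b t) (f * dirDeriv (b - a) g) =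
      f₀ * g₁ + (2 * f₀ * g₂ + f₁ * g₁) * t + (2 * f₁ * g₂ + f₂ * g₁) * t ^ 2 +
        (2 * f₂ * g₂) * t ^ 3 := by
    intro t
    rw [evalAt_mul, hF, hG']
    ring
  simp_rw [this, integral_cubic]
  ring

/-- The condition that a quadratic polynomial is orthogonal to the affine functions on the edge from
`a` to `b`, in terms of its values: its restriction is a multiple of the Legendre polynomial of degree
two. -/
def IsLegendre (a b : Plane) (p : Poly) : Prop :=
  evalAt a p = evalAt b p ∧ evalAt (midpoint ℝ a b) p = -evalAt a p / 2

/-- The partial derivatives of a cubic polynomial are orthogonal to the affine functions on an edge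
if it vanishes at the end points of the edge, has mean zero over the edge, and its normal derivative
is orthogonal to the affine functions. -/
theorem isLegendre_pderiv {a b : Plane} (hab : a ≠ b) {p : Poly} (hp : p.totalDegree ≤ 3)
    (ha : evalAt a p = 0) (hb : evalAt b p = 0) (hm : edgeIntegral a b p = 0)
    (hn : ∀ q : Poly, q.totalDegree ≤ 1 → edgeIntegral a b (q * normalDeriv a b p) = 0) (i : Fin 2) :
    IsLegendre a b (pderiv i p) := by
  have hd : dist a b ≠ 0 := dist_ne_zero.2 hab
  have hdeg (j : Fin 2) : (pderiv j p).totalDegree ≤ 2 := totalDegree_pderiv_le j hp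
  -- the tangential derivative
  have ht : IsLegendre a b (dirDeriv (b - a) p) := by
    obtain ⟨c₀, c₁, c₂, c₃, h, h'⟩ := exists_cubic_trace a b hp
    have h0 := h 0
    have h1 := h 1
    have k0 := h' 0
    have k1 := h' 1
    have km := h' (1 / 2)
    rw [AffineMap.lineMap_apply_zero] at h0 k0
    rw [AffineMap.lineMap_apply_one] at h1 k1
    rw [lineMap_half] at km
    rw [edgeIntegral] at hm
    simp_rw [h, integral_cubic] at hm
    have hm := (mul_eq_zero.1 hm).resolve_left hd
    rw [ha] at h0
    rw [hb] at h1
    refine ⟨?_, ?_⟩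
    · rw [k0, k1]; linarith
    · rw [km, k0]; linarith
  -- the normal derivative
  have hn' : IsLegendre a b (normalDeriv a b p) := by
    have hN : (normalDeriv a b p).totalDegree ≤ 2 := by
      simp only [normalDeriv, Fin.sum_univ_two, LinearMap.add_apply, LinearMap.smul_apply]
      refine (totalDegree_add _ _).trans (max_le ?_ ?_) <;>
        exact (totalDegree_smul_le _ _).trans (hdeg _)
    obtain ⟨c₀, c₁, c₂, h, -⟩ := exists_quadratic_trace a b hN
    have h0 := h 0
    have h1 := h 1
    have km := h (1 / 2)
    rw [AffineMap.lineMap_apply_zero] at h0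
    rw [AffineMap.lineMap_apply_one] at h1
    rw [lineMap_half] at km
    have m0 : c₀ + c₁ / 2 + c₂ / 3 = 0 := by
      have := hn 1 (by simp)
      rw [one_mul, edgeIntegral] at this
      have := (mul_eq_zero.1 this).resolve_left hd
      have e := integral_cubic c₀ c₁ c₂ 0
      simp only [zero_mul, add_zero, zero_div] at e
      simp_rw [h] at this
      linarith
    have m1 : c₀ / 2 + c₁ / 3 + c₂ / 4 = 0 := by
      have hX (j : Fin 2) : (b j - a j) * (c₀ / 2 + c₁ / 3 + c₂ / 4) = 0 := by
        have := hn (X j) (by simp)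
        rw [edgeIntegral] at this
        have := (mul_eq_zero.1 this).resolve_left hd
        have e : ∀ t : ℝ, evalAt (AffineMap.lineMap a b t) (X j * normalDeriv a b p) =
            a j * c₀ + (a j * c₁ + (b j - a j) * c₀) * t +
            (a j * c₂ + (b j - a j) * c₁) * t ^ 2 + ((b j - a j) * c₂) * t ^ 3 := by
          intro t
          rw [evalAt_mul, h, evalAt_X, lineMap_eq]
          simp
          ring
        simp_rw [e, integral_cubic] at this
        linear_combination this - a j * m0
      by_contra hne
      refine hab (PiLp.ext fun j => ?_)
      linarith [(mul_eq_zero.1 (hX j)).resolve_right hne]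
    refine ⟨?_, ?_⟩
    · rw [h0, h1]; linarith
    · rw [km, h0]; linarith
  have hsq : dist a b ^ 2 = (b 0 - a 0) ^ 2 + (b 1 - a 1) ^ 2 := by
    rw [EuclideanSpace.dist_eq, Real.sq_sqrt (by positivity)]
    simp [Fin.sum_univ_two, Real.dist_eq, sq_abs]
    ring
  -- the partial derivatives in terms of the tangential and the normal one
  have key : ∃ r s : ℝ, ∀ x, evalAt x (pderiv i p) =
      r * evalAt x (dirDeriv (b - a) p) + s * evalAt x (normalDeriv a b p) := by
    have hsq' : (b 0 - a 0) ^ 2 + (b 1 - a 1) ^ 2 ≠ 0 := hsq ▸ pow_ne_zero 2 hd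
    fin_cases i
    · refine ⟨(b 0 - a 0) / dist a b ^ 2, (b 1 - a 1) / dist a b, fun x => ?_⟩
      simp [normalDeriv, dirDeriv_apply, Fin.sum_univ_two, unitNormal]
      field_simp
      rw [hsq]
      ring
    · refine ⟨(b 1 - a 1) / dist a b ^ 2, -(b 0 - a 0) / dist a b, fun x => ?_⟩
      simp [normalDeriv, dirDeriv_apply, Fin.sum_univ_two, unitNormal]
      field_simp
      rw [hsq]
      ring
  obtain ⟨r, s, hrs⟩ := key
  obtain ⟨t1, t2⟩ := ht
  obtain ⟨n1, n2⟩ := hn'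
  refine ⟨?_, ?_⟩
  · rw [hrs, hrs, t1, n1]
  · rw [hrs, hrs, t2, n2]; ring

/-! ### Orientation -/

section cross

variable (a b c x y : Plane)

theorem cross_rotate : cross b c a = cross a b c := by unfold cross; ring

theorem cross_swap : cross b a c = -cross a b c := by unfold cross; ring

@[simp] theorem cross_self_left : cross a b a = 0 := by unfold cross; ring

@[simp] theorem cross_self_right : cross a b b = 0 := by unfold cross; ring

@[simp] theorem cross_self : cross a a b = 0 := by unfold cross; ring

@[simp] theorem cross_midpoint_self : cross a b (midpoint ℝ a b) = 0 := by
  simp [cross, midpoint_eq_smul_add]; ring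

theorem cross_combo (s t : ℝ) (h : s + t = 1) :
    cross a b (s • x + t • y) = s * cross a b x + t * cross a b y := by
  obtain rfl : s = 1 - t := by linarith
  simp [cross]; ring

theorem continuous_cross : Continuous (cross a b) := by
  unfold cross; fun_prop

theorem convex_cross_pos : Convex ℝ {x | 0 < cross a b x} := by
  intro x hx y hy s t hs ht hst
  rw [Set.mem_ofPred_eq, cross_combo _ _ _ _ _ _ hst]
  rcases hs.eq_or_lt with rfl | hs
  · obtain rfl : t = 1 := by linarith
    simpa using hy
  · have h1 := mul_pos hs hx
    have h2 := mul_nonneg ht (le_of_lt hy)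
    linarith

theorem convex_cross_nonpos : Convex ℝ {x | cross a b x ≤ 0} := by
  intro x hx y hy s t hs ht hst
  rw [Set.mem_ofPred_eq, cross_combo _ _ _ _ _ _ hst]
  have h1 := mul_nonpos_of_nonneg_of_nonpos hs hx
  have h2 := mul_nonpos_of_nonneg_of_nonpos ht hy
  linarith

variable {a b c x y}

theorem cross_eq_zero_of_mem_segment (h : x ∈ segment ℝ a b) : cross a b x = 0 := by
  obtain ⟨s, t, -, -, hst, rfl⟩ := h
  rw [cross_combo _ _ _ _ _ _ hst]
  simp

theorem ne_of_cross_pos (h : 0 < cross a b c) : a ≠ b ∧ b ≠ c ∧ c ≠ a := by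
  refine ⟨?_, ?_, ?_⟩ <;> rintro rfl <;> simp at h

theorem cross_ne_zero_of_affineIndependent (h : AffineIndependent ℝ ![a, b, c]) :
    cross a b c ≠ 0 := by
  intro h0
  have key (j : Fin 2) : (b j - a j) = 0 := by
    have := (affineIndependent_iff.1 h) Finset.univ
      ![(b j - a j) - (c j - a j), c j - a j, -(b j - a j)] ?_ ?_ 2 (Finset.mem_univ _)
    · rw [← neg_eq_zero]
      simpa using this
    · simp [Fin.sum_univ_three]
    · unfold cross at h0
      ext k
      simp [Fin.sum_univ_three]
      fin_cases j <;> fin_cases k <;> simp at h0 ⊢ <;> linarith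
  have hab : a = b := PiLp.ext fun j => by linarith [key j]
  have := h.injective.ne (show (0 : Fin 3) ≠ 1 by decide)
  exact this (by simpa using hab)

end cross

/-- The triangle with vertices `T` has the oriented edge `ab`, that is, it lies to the left of `ab`. -/
def IsLeft (T : Finset Plane) (a b : Plane) : Prop :=
  a ∈ T ∧ b ∈ T ∧ ∃ c ∈ T, 0 < cross a b c

/-- The oriented boundary edges of a triangle. -/
def leftEdges (T : Finset Plane) : Finset (Plane × Plane) :=
  (T ×ˢ T).filter fun e => IsLeft T e.1 e.2

theorem mem_leftEdges {T : Finset Plane} {e : Plane × Plane} :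
    e ∈ leftEdges T ↔ IsLeft T e.1 e.2 := by
  simp only [leftEdges, Finset.mem_filter, Finset.mem_product, and_iff_right_iff_imp]
  exact fun h => ⟨h.1, h.2.1⟩

theorem IsLeft.ne {T : Finset Plane} {a b : Plane} (h : IsLeft T a b) : a ≠ b :=
  let ⟨_, _, _, _, hc⟩ := h
  (ne_of_cross_pos hc).1

theorem leftEdges_eq {a b c : Plane} (h : 0 < cross a b c) :
    leftEdges {a, b, c} = {(a, b), (b, c), (c, a)} := by
  have hb : 0 < cross b c a := by rwa [cross_rotate]
  have hc : 0 < cross c a b := by rwa [cross_rotate]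
  ext ⟨x, y⟩
  rw [mem_leftEdges]
  constructor
  · rintro ⟨hx, hy, z, hz, hpos⟩
    simp only [Finset.mem_insert, Finset.mem_singleton] at hx hy hz
    have e1 := cross_swap a b c
    have e2 := cross_swap b c a
    have e3 := cross_swap c a b
    rcases hx with rfl | rfl | rfl <;> rcases hy with rfl | rfl | rfl <;>
      rcases hz with rfl | rfl | rfl <;> 
      first
        | (simp; done)
        | (exfalso; simp at hpos; done)
        | (exfalso; simp only at hpos; linarith)
  · simp only [Finset.mem_insert, Finset.mem_singleton, Prod.mk.injEq]
    rintro (⟨rfl, rfl⟩ | ⟨rfl, rfl⟩ | ⟨rfl, rfl⟩)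
    · exact ⟨by simp, by simp, c, by simp, h⟩
    · exact ⟨by simp, by simp, a, by simp, hb⟩
    · exact ⟨by simp, by simp, b, by simp, hc⟩

theorem sum_leftEdges {A : Type*} [AddCommGroup A] {a b c : Plane} (h : 0 < cross a b c)
    (F : Plane × Plane → A) :
    ∑ e ∈ leftEdges {a, b, c}, F e = F (a, b) + F (b, c) + F (c, a) := by
  obtain ⟨h1, h2, h3⟩ := ne_of_cross_pos h
  rw [leftEdges_eq h, Finset.sum_insert, Finset.sum_insert, Finset.sum_singleton, add_assoc]
  · simp [h2, h3]
  · simp [h1, h3.symm]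

/-- The open triangle, as intersection of half-planes. -/
def openTriangle (T : Finset Plane) : Set Plane := {x | ∀ e ∈ leftEdges T, 0 < cross e.1 e.2 x}

theorem isOpen_openTriangle (T : Finset Plane) : IsOpen (openTriangle T) := by
  have : openTriangle T = ⋂ e ∈ leftEdges T, {x | 0 < cross e.1 e.2 x} := by
    ext x; simp [openTriangle]
  rw [this]
  exact isOpen_biInter_finset fun e _ => isOpen_lt continuous_const (continuous_cross _ _)

theorem convex_openTriangle (T : Finset Plane) : Convex ℝ (openTriangle T) := by
  have : openTriangle T = ⋂ e ∈ leftEdges T, {x | 0 < cross e.1 e.2 x} := by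
    ext x; simp [openTriangle]
  rw [this]
  exact convex_iInter₂ fun e _ => convex_cross_pos _ _

theorem mem_openTriangle {a b c x : Plane} (h : 0 < cross a b c) :
    x ∈ openTriangle {a, b, c} ↔ 0 < cross a b x ∧ 0 < cross b c x ∧ 0 < cross c a x := by
  rw [openTriangle, Set.mem_ofPred_eq, leftEdges_eq h]
  simp

theorem exists_frame_eq {a b c : Plane} (h : cross a b c ≠ 0) (x : Plane) :
    x = frame a b c (cross c a x / cross a b c, cross a b x / cross a b c) := by
  ext i
  unfold cross at h ⊢
  simp only [frame]
  fin_cases i <;> simp <;> field_simp <;> ring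

theorem region_eq (a b c : Plane) : region {a, b, c} = convexHull ℝ {a, b, c} := by
  simp [region]

theorem openTriangle_subset_region {a b c : Plane} (h : 0 < cross a b c) :
    openTriangle {a, b, c} ⊆ region {a, b, c} := by
  intro x hx
  rw [mem_openTriangle h] at hx
  rw [region_eq, convexHull_triple]
  refine ⟨_, ?_, (exists_frame_eq h.ne' x).symm⟩
  refine ⟨(div_pos hx.2.2 h).le, (div_pos hx.1 h).le, ?_⟩
  rw [← add_div, div_le_one h]
  have : cross a b x + cross b c x + cross c a x = cross a b c := by unfold cross; ring
  linarith [hx.2.1]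

/-- A triangle to the left of `ab` contains all points near the midpoint of `ab` and to the left of
`ab`. -/
theorem eventually_mem_openTriangle {a b c v : Plane} (h : 0 < cross a b c)
    (hv : 0 < cross a b (midpoint ℝ a b + v)) :
    ∀ᶠ s : ℝ in 𝓝[>] 0, midpoint ℝ a b + s • v ∈ openTriangle {a, b, c} := by
  simp only [mem_openTriangle h, eventually_and]
  have hc (p q : Plane) : ContinuousAt (fun s : ℝ => cross p q (midpoint ℝ a b + s • v)) 0 :=
    ((continuous_cross p q).comp (by fun_prop)).continuousAt
  refine ⟨?_, ?_, ?_⟩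
  · filter_upwards [self_mem_nhdsWithin] with s hs
    have : cross a b (midpoint ℝ a b + s • v) = s * cross a b (midpoint ℝ a b + v) := by
      simp [cross, midpoint_eq_smul_add]; ring
    rw [this]
    exact mul_pos hs hv
  · refine ((hc b c).mono_left nhdsWithin_le_nhds).eventually (lt_mem_nhds ?_)
    have : cross b c (midpoint ℝ a b) = cross a b c / 2 := by
      simp [cross, midpoint_eq_smul_add]; ring
    simp [this, h]
  · refine ((hc c a).mono_left nhdsWithin_le_nhds).eventually (lt_mem_nhds ?_)
    have : cross c a (midpoint ℝ a b) = cross a b c / 2 := by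
      simp [cross, midpoint_eq_smul_add]; ring
    simp [this, h]

/-! ### Triangles and edges of a mesh -/

namespace Mesh

variable {Ω : Set Plane} (M : Mesh Ω)

theorem mem_triangles {T : Finset Plane} : T ∈ M.triangles ↔ T ∈ M.complex.faces ∧ T.card = 3 := by
  simp [triangles]

theorem cross_ne_zero {a b c : Plane} (hab : a ≠ b) (hbc : b ≠ c) (hca : c ≠ a)
    (h : ({a, b, c} : Finset Plane) ∈ M.complex.faces) : cross a b c ≠ 0 := by
  have hind := M.complex.indep h
  let f : Fin 3 ↪ ({a, b, c} : Finset Plane) :=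
    ⟨![⟨a, by simp⟩, ⟨b, by simp⟩, ⟨c, by simp⟩], by
      intro i j hij
      fin_cases i <;> fin_cases j <;> simp_all⟩
  have := hind.comp_embedding f
  apply cross_ne_zero_of_affineIndependent
  have hf : ![a, b, c] = ((↑) : ({a, b, c} : Finset Plane) → Plane) ∘ f := by
    ext i : 1
    fin_cases i <;> rfl
  rwa [hf]

/-- Every triangle of the mesh has a positively oriented enumeration of its vertices. -/
theorem exists_vertices {T : Finset Plane} (hT : T ∈ M.triangles) :
    ∃ a b c, 0 < cross a b c ∧ T = {a, b, c} := by
  obtain ⟨hf, hc⟩ := M.mem_triangles.1 hT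
  obtain ⟨a, b, c, hab, hac, hbc, rfl⟩ := Finset.card_eq_three.1 hc
  rcases lt_or_gt_of_ne (M.cross_ne_zero hab hbc hac.symm hf) with h | h
  · refine ⟨b, a, c, by rw [cross_swap]; linarith, ?_⟩
    ext x; simp; tauto
  · exact ⟨a, b, c, h, rfl⟩

/-- The third vertex of a triangle to the left of `ab`. -/
theorem exists_apex {T : Finset Plane} (hT : T ∈ M.triangles) {a b : Plane} (h : IsLeft T a b) :
    ∃ c, 0 < cross a b c ∧ T = {a, b, c} := by
  obtain ⟨ha, hb, c, hc, hpos⟩ := h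
  obtain ⟨h1, h2, h3⟩ := ne_of_cross_pos hpos
  refine ⟨c, hpos, (Finset.eq_of_subset_of_card_le ?_ ?_).symm⟩
  · intro x hx
    simp only [Finset.mem_insert, Finset.mem_singleton] at hx
    rcases hx with rfl | rfl | rfl <;> assumption
  · rw [(M.mem_triangles.1 hT).2, Finset.card_eq_three.2 ⟨a, b, c, h1, h3.symm, h2, rfl⟩]

theorem pair_mem_edges {T : Finset Plane} (hT : T ∈ M.triangles) {a b : Plane} (ha : a ∈ T)
    (hb : b ∈ T) (hab : a ≠ b) : {a, b} ∈ M.edges := by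
  refine ⟨M.complex.down_closed (M.mem_triangles.1 hT).1 ?_ (by simp), Finset.card_pair hab⟩
  simp [Finset.insert_subset_iff, ha, hb]

theorem region_inter_subset {s t : Finset Plane} (hs : s ∈ M.complex.faces)
    (ht : t ∈ M.complex.faces) : region s ∩ region t ⊆ region (s ∩ t) := by
  simpa [region] using M.complex.inter_subset_convexHull hs ht

/-- There is at most one triangle on each side of an edge. -/
theorem isLeft_unique {T T' : Finset Plane} (hT : T ∈ M.triangles) (hT' : T' ∈ M.triangles)
    {a b : Plane} (h : IsLeft T a b) (h' : IsLeft T' a b) : T = T' := by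
  obtain ⟨c, hc, rfl⟩ := M.exists_apex hT h
  obtain ⟨c', hc', rfl⟩ := M.exists_apex hT' h'
  have hv : 0 < cross a b (midpoint ℝ a b + (c - a)) := by
    have : cross a b (midpoint ℝ a b + (c - a)) = cross a b c := by
      simp [cross, midpoint_eq_smul_add]; ring
    rwa [this]
  obtain ⟨s, hs⟩ := ((eventually_mem_openTriangle hc hv).and
    (eventually_mem_openTriangle hc' hv)).exists
  set x := midpoint ℝ a b + s • (c - a)
  by_contra hne
  have hx := M.region_inter_subset (M.mem_triangles.1 hT).1 (M.mem_triangles.1 hT').1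
    ⟨openTriangle_subset_region hc hs.1, openTriangle_subset_region hc' hs.2⟩
  have hcc : c ≠ c' := by rintro rfl; exact hne rfl
  have hsub : (({a, b, c} ∩ {a, b, c'} : Finset Plane) : Set Plane) ⊆ {x | cross a b x ≤ 0} := by
    intro y hy
    simp only [Finset.coe_inter, Finset.coe_insert, Finset.coe_singleton, Set.mem_inter_iff,
      Set.mem_insert_iff, Set.mem_singleton_iff] at hy
    obtain ⟨rfl | rfl | rfl, h2⟩ := hy
    · simp
    · simp
    · rcases h2 with rfl | rfl | h2
      · simp
      · simp
      · exact absurd h2 hcc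
  have := convexHull_min hsub (convex_cross_nonpos a b) hx
  have h2 := ((mem_openTriangle hc).1 hs.1).1
  exact absurd this (not_le.2 h2)

/-- An edge which is not contained in the boundary has a triangle on each side. -/
theorem exists_isLeft (hΩ : IsOpen Ω) {a b : Plane} (hab : a ≠ b)
    (he : {a, b} ∈ M.interiorEdges) : ∃ T ∈ M.triangles, IsLeft T a b := by
  obtain ⟨⟨hface, -⟩, hfr⟩ := he
  -- an interior point of the edge that lies in `Ω`
  obtain ⟨t, ht, htΩ⟩ : ∃ t ∈ Set.Ioo (0 : ℝ) 1, AffineMap.lineMap a b t ∈ Ω := by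
    rw [Set.not_subset] at hfr
    obtain ⟨y, hy, hyf⟩ := hfr
    have hyΩ : y ∈ Ω := by
      have h1 : y ∈ closure Ω := by
        rw [← M.space_eq]
        exact M.complex.convexHull_subset_space hface hy
      by_contra h2
      exact hyf ⟨h1, by rwa [hΩ.interior_eq]⟩
    rw [Finset.coe_pair, convexHull_pair, segment_eq_image_lineMap] at hy
    obtain ⟨t, ht, rfl⟩ := hy
    have hopen : IsOpen ((AffineMap.lineMap a b : ℝ → Plane) ⁻¹' Ω) :=
      hΩ.preimage AffineMap.lineMap_continuous
    have hcl : t ∈ closure (Set.Ioo (0 : ℝ) 1) := by rwa [closure_Ioo (by norm_num)]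
    obtain ⟨s, hs, hs'⟩ := mem_closure_iff.1 hcl _ hopen hyΩ
    exact ⟨s, hs', hs⟩
  set x : Plane := AffineMap.lineMap a b t with hx
  let v : Plane := !₂[-(b 1 - a 1), b 0 - a 0]
  have hcross (s : ℝ) : cross a b (x + s • v) = s * ((b 0 - a 0) ^ 2 + (b 1 - a 1) ^ 2) := by
    simp [hx, cross, v, lineMap_eq]; ring
  have hpos : 0 < (b 0 - a 0) ^ 2 + (b 1 - a 1) ^ 2 := by
    by_contra hle
    refine hab (PiLp.ext fun j => ?_)
    fin_cases j <;> simp <;> nlinarith [sq_nonneg (b 0 - a 0), sq_nonneg (b 1 - a 1)]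
  have hcont : Tendsto (fun s : ℝ => x + s • v) (𝓝[>] 0) (𝓝 x) := by
    have : Continuous fun s : ℝ => x + s • v := by fun_prop
    simpa using (this.tendsto 0).mono_left nhdsWithin_le_nhds
  -- some face contains points to the left of `ab` that are arbitrarily close to `x`
  obtain ⟨F, hF, hFx⟩ : ∃ F ∈ M.complex.faces, ∃ᶠ s : ℝ in 𝓝[>] 0, x + s • v ∈ region F := by
    by_contra hcon
    push Not at hcon
    have h1 := (eventually_all_finite M.finite_faces).2 hcon
    have h2 := hcont.eventually (hΩ.mem_nhds htΩ)
    obtain ⟨s, hs1, hs2⟩ := (h1.and h2).exists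
    have h3 : x + s • v ∈ M.complex.space := by rw [M.space_eq]; exact subset_closure hs2
    obtain ⟨F, hF, hF'⟩ := M.complex.mem_space_iff.1 h3
    exact hs1 F hF hF'
  have hFclosed : IsClosed (region F) := F.finite_toSet.isClosed_convexHull ℝ
  have hxF : x ∈ region F := hFclosed.mem_of_frequently_of_tendsto hFx hcont
  have hxe : x ∈ region {a, b} := by
    rw [region, Finset.coe_pair, convexHull_pair, segment_eq_image_lineMap]
    exact ⟨t, ⟨ht.1.le, ht.2.le⟩, rfl⟩
  have hxFe := M.region_inter_subset hF hface ⟨hxF, hxe⟩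
  -- `x` is not a vertex, so that both end points belong to `F`
  have hxa : x ≠ a := by
    intro h
    rw [hx, AffineMap.lineMap_eq_left_iff] at h
    exact h.elim hab ht.1.ne'
  have hxb : x ≠ b := by
    intro h
    rw [hx, AffineMap.lineMap_eq_right_iff] at h
    exact h.elim hab ht.2.ne
  have haF : a ∈ F := by
    by_contra hn
    have : F ∩ {a, b} ⊆ {b} := by
      intro y; simp only [Finset.mem_inter, Finset.mem_insert, Finset.mem_singleton]
      rintro ⟨h1, rfl | rfl⟩
      · exact absurd h1 hn
      · rfl
    have := convexHull_mono (𝕜 := ℝ) (Finset.coe_subset.2 this) hxFe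
    exact hxb (by simpa using this)
  have hbF : b ∈ F := by
    by_contra hn
    have : F ∩ {a, b} ⊆ {a} := by
      intro y; simp only [Finset.mem_inter, Finset.mem_insert, Finset.mem_singleton]
      rintro ⟨h1, rfl | rfl⟩
      · rfl
      · exact absurd h1 hn
    have := convexHull_mono (𝕜 := ℝ) (Finset.coe_subset.2 this) hxFe
    exact hxa (by simpa using this)
  obtain ⟨c, hcF, hc⟩ : ∃ c ∈ F, 0 < cross a b c := by
    by_contra hcon
    push Not at hcon
    have hsub : (F : Set Plane) ⊆ {x | cross a b x ≤ 0} := fun y hy => hcon y hy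
    obtain ⟨s, hs, hs0⟩ := (hFx.and_eventually self_mem_nhdsWithin).exists
    have := convexHull_min hsub (convex_cross_nonpos a b) hs
    rw [Set.mem_ofPred_eq, hcross] at this
    exact absurd this (not_le.2 (mul_pos hs0 hpos))
  obtain ⟨-, h2, h3⟩ := ne_of_cross_pos hc
  have hcard : ({a, b, c} : Finset Plane).card = 3 :=
    Finset.card_eq_three.2 ⟨a, b, c, hab, h3.symm, h2, rfl⟩
  refine ⟨{a, b, c}, M.mem_triangles.2 ⟨M.complex.down_closed hF ?_ (by simp), hcard⟩, by simp,
    by simp, c, by simp, hc⟩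
  simp [Finset.insert_subset_iff, haF, hbF, hcF]

/-- A sum over all oriented edges of all triangles vanishes if the contributions from the two sides of
each interior edge cancel, and the contributions from the boundary edges vanish. -/
theorem sum_leftEdges_eq_zero (hΩ : IsOpen Ω) {A : Type*} [AddCommGroup A] [Module ℝ A]
    (F : M.triangles → Plane × Plane → A)
    (hint : ∀ (T T' : M.triangles) (a b : Plane), {a, b} ∈ M.interiorEdges → IsLeft T.1 a b →
      IsLeft T'.1 b a → F T (a, b) + F T' (b, a) = 0)
    (hbd : ∀ (T : M.triangles) (a b : Plane), {a, b} ∈ M.boundaryEdges → IsLeft T.1 a b →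
      F T (a, b) = 0) :
    ∑ T : M.triangles, ∑ e ∈ leftEdges T.1, F T e = 0 := by
  let V : Finset Plane := M.triangles.biUnion id
  let H : Plane → Plane → A := fun a b => ∑ T : M.triangles, if IsLeft T.1 a b then F T (a, b) else 0
  have hsum : ∑ T : M.triangles, ∑ e ∈ leftEdges T.1, F T e = ∑ a ∈ V, ∑ b ∈ V, H a b := by
    rw [← Finset.sum_product', Finset.sum_comm]
    refine Finset.sum_congr rfl fun T _ => ?_
    rw [← Finset.sum_filter]
    refine Finset.sum_congr ?_ fun _ _ => rfl
    ext ⟨a, b⟩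
    simp only [mem_leftEdges, Finset.mem_filter, Finset.mem_product]
    refine ⟨fun h => ⟨⟨?_, ?_⟩, h⟩, fun h => h.2⟩
    · exact Finset.mem_biUnion.2 ⟨T.1, T.2, h.1⟩
    · exact Finset.mem_biUnion.2 ⟨T.1, T.2, h.2.1⟩
  have hone (a b : Plane) (T : M.triangles) (h : IsLeft T.1 a b) : H a b = F T (a, b) := by
    simp only [H]
    rw [Finset.sum_eq_single T, if_pos h]
    · intro T' _ hne
      exact if_neg fun h' => hne (Subtype.ext (M.isLeft_unique T'.2 T.2 h' h))
    · simp
  have hanti (a b : Plane) : H a b + H b a = 0 := by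
    have key (a b : Plane) (T : M.triangles) (h : IsLeft T.1 a b) : H a b + H b a = 0 := by
      have hne := h.ne
      have hedge := M.pair_mem_edges T.2 h.1 h.2.1 hne
      by_cases hf : convexHull ℝ (({a, b} : Finset Plane) : Set Plane) ⊆ frontier Ω
      · have h1 (T' : M.triangles) (h' : IsLeft T'.1 b a) : F T' (b, a) = 0 :=
          hbd T' b a (by rw [Finset.pair_comm]; exact ⟨hedge, hf⟩) h'
        rw [hone a b T h, hbd T a b ⟨hedge, hf⟩ h, zero_add]
        refine Finset.sum_eq_zero fun T' _ => ?_
        split_ifs with h'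
        · exact h1 T' h'
        · rfl
      · obtain ⟨T', hT', h'⟩ := M.exists_isLeft hΩ hne.symm
          (by rw [Finset.pair_comm]; exact ⟨hedge, hf⟩)
        rw [hone a b T h, hone b a ⟨T', hT'⟩ h']
        exact hint _ _ _ _ ⟨hedge, hf⟩ h h'
    by_cases h : ∃ T : M.triangles, IsLeft T.1 a b
    · obtain ⟨T, hT⟩ := h
      exact key a b T hT
    by_cases h' : ∃ T : M.triangles, IsLeft T.1 b a
    · obtain ⟨T, hT⟩ := h'
      rw [add_comm]
      exact key b a T hT
    push Not at h h'
    have e1 : H a b = 0 := Finset.sum_eq_zero fun T _ => if_neg (h T)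
    have e2 : H b a = 0 := Finset.sum_eq_zero fun T _ => if_neg (h' T)
    rw [e1, e2, add_zero]
  rw [hsum]
  have h2 : (∑ a ∈ V, ∑ b ∈ V, H a b) + ∑ a ∈ V, ∑ b ∈ V, H a b = 0 := by
    nth_rewrite 2 [Finset.sum_comm]
    simp_rw [← Finset.sum_add_distrib]
    exact Finset.sum_eq_zero fun a _ => Finset.sum_eq_zero fun b _ => hanti a b
  rw [← two_smul ℝ] at h2
  exact (smul_eq_zero.1 h2).resolve_left two_ne_zero

end Mesh

/-! ### The nonconforming quadratic space -/

theorem isLegendre_zero (a b : Plane) : IsLegendre a b 0 := by simp [IsLegendre]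

theorem IsLegendre.add {a b : Plane} {p q : Poly} (hp : IsLegendre a b p) (hq : IsLegendre a b q) :
    IsLegendre a b (p + q) := by
  obtain ⟨h1, h2⟩ := hp
  obtain ⟨h3, h4⟩ := hq
  refine ⟨?_, ?_⟩
  · simp [h1, h3]
  · rw [evalAt_add, evalAt_add, h2, h4]; ring

theorem IsLegendre.smul {a b : Plane} {p : Poly} (hp : IsLegendre a b p) (c : ℝ) :
    IsLegendre a b (c • p) := by
  obtain ⟨h1, h2⟩ := hp
  refine ⟨?_, ?_⟩
  · simp [h1]
  · rw [evalAt_smul, evalAt_smul, h2]; ring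

/-- The nonconforming piecewise quadratic functions of Fortin and Soulie: the jumps across the interior
edges and the traces on the boundary edges are orthogonal to the affine functions. -/
def fortinSoulie {Ω : Set Plane} (M : Mesh Ω) : Submodule ℝ (Broken M) where
  carrier := {f | (∀ T, (f T).totalDegree ≤ 2) ∧
    (∀ a b : Plane, {a, b} ∈ M.interiorEdges → a ≠ b → ∀ T T' : M.triangles, a ∈ T.1 → b ∈ T.1 →
      a ∈ T'.1 → b ∈ T'.1 → IsLegendre a b (f T - f T')) ∧
    (∀ a b : Plane, {a, b} ∈ M.boundaryEdges → a ≠ b → ∀ T : M.triangles, a ∈ T.1 → b ∈ T.1 →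
      IsLegendre a b (f T))}
  zero_mem' := by simp [isLegendre_zero]
  add_mem' := by
    rintro f g ⟨hf1, hf2, hf3⟩ ⟨hg1, hg2, hg3⟩
    refine ⟨fun T => (totalDegree_add _ _).trans (max_le (hf1 T) (hg1 T)), ?_, ?_⟩
    · intro a b he hab T T' h1 h2 h3 h4
      rw [Pi.add_apply, Pi.add_apply, add_sub_add_comm]
      exact (hf2 a b he hab T T' h1 h2 h3 h4).add (hg2 a b he hab T T' h1 h2 h3 h4)
    · intro a b he hab T h1 h2
      exact (hf3 a b he hab T h1 h2).add (hg3 a b he hab T h1 h2)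
  smul_mem' := by
    rintro c f ⟨hf1, hf2, hf3⟩
    refine ⟨fun T => (totalDegree_smul_le _ _).trans (hf1 T), ?_, ?_⟩
    · intro a b he hab T T' h1 h2 h3 h4
      rw [Pi.smul_apply, Pi.smul_apply, ← smul_sub]
      exact (hf2 a b he hab T T' h1 h2 h3 h4).smul c
    · intro a b he hab T h1 h2
      exact (hf3 a b he hab T h1 h2).smul c

theorem Mesh.mem_frontier_of_boundaryEdge {Ω : Set Plane} (M : Mesh Ω) {a b : Plane}
    (he : {a, b} ∈ M.boundaryEdges) : a ∈ frontier Ω :=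
  he.2 (subset_convexHull ℝ _ (by simp))

/-- The partial derivatives of the functions in `B³_{h0}` belong to the Fortin–Soulie space. -/
theorem pderiv_mem_fortinSoulie {Ω : Set Plane} {M : Mesh Ω} {v : Broken M} (hv : v ∈ B30 M)
    (i : Fin 2) : (fun T => pderiv i (v T)) ∈ fortinSoulie M := by
  obtain ⟨⟨hdeg, hvert, hjump⟩, hvert0, hbd⟩ := hv
  refine ⟨fun T => totalDegree_pderiv_le i (hdeg T), ?_, ?_⟩
  · intro a b he hab T T' h1 h2 h3 h4
    have hs : ({a, b} : Finset Plane) ⊆ T.1 := by simp [Finset.insert_subset_iff, h1, h2]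
    have hs' : ({a, b} : Finset Plane) ⊆ T'.1 := by simp [Finset.insert_subset_iff, h3, h4]
    obtain ⟨k1, k2⟩ := hjump _ he T T' hs hs' a (by simp) b (by simp) hab
    rw [← map_sub]
    refine isLegendre_pderiv hab ((totalDegree_sub _ _).trans (max_le (hdeg T) (hdeg T'))) ?_ ?_ k1
      (fun q hq => ?_) i
    · rw [evalAt_sub, hvert T T' a h1 h3, sub_self]
    · rw [evalAt_sub, hvert T T' b h2 h4, sub_self]
    · rw [map_sub]
      exact k2 q hq
  · intro a b he hab T h1 h2
    have hs : ({a, b} : Finset Plane) ⊆ T.1 := by simp [Finset.insert_subset_iff, h1, h2]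
    obtain ⟨k1, k2⟩ := hbd _ he T hs a (by simp) b (by simp) hab
    have he' : {b, a} ∈ M.boundaryEdges := by rwa [Finset.pair_comm]
    exact isLegendre_pderiv hab (hdeg T) (hvert0 T a h1 (M.mem_frontier_of_boundaryEdge he))
      (hvert0 T b h2 (M.mem_frontier_of_boundaryEdge he')) k1 k2 i

/-! ### Constants with prescribed jumps -/

/-- The coefficient of the quadratic Legendre polynomial (normalized to be `1` at the end points) in
the restriction of a quadratic polynomial to the edge from `a` to `b`. -/
def legendreCoeff (p : Poly) (e : Plane × Plane) : ℝ :=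
  (evalAt e.1 p - 2 * evalAt (midpoint ℝ e.1 e.2) p + evalAt e.2 p) / 3

theorem IsLegendre.legendreCoeff_eq {a b : Plane} {p q : Poly} (h : IsLegendre a b (p - q)) :
    legendreCoeff p (a, b) - legendreCoeff q (b, a) = evalAt a p - evalAt a q ∧
      legendreCoeff p (a, b) - legendreCoeff q (b, a) = evalAt b p - evalAt b q := by
  obtain ⟨h1, h2⟩ := h
  rw [evalAt_sub, evalAt_sub] at h1 h2
  simp only [legendreCoeff, midpoint_comm b a]
  constructor <;> linarith

theorem IsLegendre.legendreCoeff_eq' {a b : Plane} {p : Poly} (h : IsLegendre a b p) :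
    legendreCoeff p (a, b) = evalAt a p ∧ legendreCoeff p (a, b) = evalAt b p := by
  obtain ⟨h1, h2⟩ := h
  simp only [legendreCoeff]
  constructor <;> linarith

/-- The identification of the plane with the complex numbers. -/
def toC : Plane ≃ₗᵢ[ℝ] ℂ := Complex.orthonormalBasisOneI.repr.symm

@[simp] theorem toC_re (x : Plane) : (toC x).re = x 0 := by
  simp [toC, Complex.orthonormalBasisOneI_repr_symm_apply]

@[simp] theorem toC_im (x : Plane) : (toC x).im = x 1 := by
  simp [toC, Complex.orthonormalBasisOneI_repr_symm_apply]

/-- The complex logarithm whose imaginary part is the angle at which the edge `e` is seen from `w`. -/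
def edgeLog (e : Plane × Plane) (w : ℂ) : ℂ := Complex.log ((toC e.2 - w) / (toC e.1 - w))

theorem div_mem_slitPlane {e : Plane × Plane} {x : Plane} (h : x ∉ segment ℝ e.1 e.2) :
    (toC e.2 - toC x) / (toC e.1 - toC x) ∈ Complex.slitPlane := by
  have h1 : toC e.1 - toC x ≠ 0 := by
    intro h0
    rw [sub_eq_zero, toC.injective.eq_iff] at h0
    exact h (h0 ▸ left_mem_segment ℝ _ _)
  by_contra hn
  rw [Complex.mem_slitPlane_iff] at hn
  push Not at hn
  set r := ((toC e.2 - toC x) / (toC e.1 - toC x)).re with hr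
  have hq : (toC e.2 - toC x) / (toC e.1 - toC x) = (r : ℂ) := by
    apply Complex.ext <;> simp [hr, hn.2]
  rw [div_eq_iff h1] at hq
  have hq' : e.2 - x = r • (e.1 - x) := by
    apply toC.injective
    rw [map_sub, hq, map_smul, map_sub]
    simp
  apply h
  have hr0 : 0 < 1 - r := by linarith [hn.1]
  refine ⟨-r / (1 - r), 1 / (1 - r), div_nonneg (by linarith [hn.1]) hr0.le, by positivity, ?_, ?_⟩
  · field_simp; ring
  · have : e.2 = x + r • (e.1 - x) := by rw [← hq']; abel
    rw [this]
    ext i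
    simp
    field_simp
    ring

theorem hasDerivAt_edgeLog {e : Plane × Plane} {x : Plane} (h : x ∉ segment ℝ e.1 e.2) :
    HasDerivAt (edgeLog e) ((toC e.1 - toC x)⁻¹ - (toC e.2 - toC x)⁻¹) (toC x) := by
  have h1 : toC e.1 - toC x ≠ 0 := by
    intro h0
    rw [sub_eq_zero, toC.injective.eq_iff] at h0
    exact h (h0 ▸ left_mem_segment ℝ _ _)
  have h2 : toC e.2 - toC x ≠ 0 := by
    intro h0
    rw [sub_eq_zero, toC.injective.eq_iff] at h0
    exact h (h0 ▸ right_mem_segment ℝ _ _)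
  have hd := (((hasDerivAt_id (toC x)).const_sub (toC e.2)).fun_div
    ((hasDerivAt_id (toC x)).const_sub (toC e.1)) h1).clog (div_mem_slitPlane h)
  refine hd.congr_deriv ?_
  simp only [id]
  field_simp
  ring

/-- The vector `b - a` rotated by a right angle to the left. -/
def leftNormal (a b : Plane) : Plane := !₂[-(b 1 - a 1), b 0 - a 0]

theorem cross_midpoint_add_leftNormal_pos {a b : Plane} (hab : a ≠ b) :
    0 < cross a b (midpoint ℝ a b + leftNormal a b) := by
  have : cross a b (midpoint ℝ a b + leftNormal a b) = (b 0 - a 0) ^ 2 + (b 1 - a 1) ^ 2 := by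
    simp [cross, leftNormal, midpoint_eq_smul_add]; ring
  rw [this]
  by_contra hle
  refine hab (PiLp.ext fun j => ?_)
  fin_cases j <;> simp <;> nlinarith [sq_nonneg (b 0 - a 0), sq_nonneg (b 1 - a 1)]

theorem leftNormal_swap (a b : Plane) : leftNormal b a = -leftNormal a b := by
  ext i; fin_cases i <;> simp [leftNormal]

theorem edgeLog_midpoint_add {a b : Plane} (hab : a ≠ b) (s : ℝ) :
    edgeLog (a, b) (toC (midpoint ℝ a b + s • leftNormal a b)) =
      Complex.log (-((1 - 2 * s * Complex.I) / (1 + 2 * s * Complex.I))) := by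
  have hd : toC b - toC a ≠ 0 := by
    rw [sub_ne_zero]; exact fun h => hab (toC.injective h).symm
  have hs : (1 + 2 * s * Complex.I : ℂ) ≠ 0 := by
    intro h
    have := congrArg Complex.re h
    simp at this
  have hm : toC (midpoint ℝ a b + s • leftNormal a b) =
      (toC a + toC b) / 2 + s * (Complex.I * (toC b - toC a)) := by
    apply Complex.ext <;> simp [leftNormal, midpoint_eq_smul_add] <;> ring
  have e1 : toC b - toC (midpoint ℝ a b + s • leftNormal a b) =
      (toC b - toC a) / 2 * (1 - 2 * s * Complex.I) := by rw [hm]; ring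
  have e2 : toC a - toC (midpoint ℝ a b + s • leftNormal a b) =
      (toC b - toC a) / 2 * -(1 + 2 * s * Complex.I) := by rw [hm]; ring
  rw [edgeLog]
  congr 1
  simp only
  rw [e1, e2, mul_div_mul_left _ _ (by simpa using hd), div_neg]

theorem im_neg_div (s : ℝ) :
    (-((1 - 2 * s * Complex.I) / (1 + 2 * s * Complex.I))).im = 4 * s / (1 + 4 * s ^ 2) := by
  have h : (1 + 4 * s ^ 2 : ℝ) ≠ 0 := by positivity
  have hn : Complex.normSq (1 + 2 * s * Complex.I) = 1 + 4 * s ^ 2 := by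
    simp [Complex.normSq_apply]; ring
  rw [Complex.neg_im, Complex.div_im, hn]
  simp
  field_simp
  ring

theorem tendsto_neg_div : Tendsto (fun s : ℝ => -((1 - 2 * s * Complex.I) / (1 + 2 * s * Complex.I)))
    (𝓝 0) (𝓝 (-1)) := by
  have h : ContinuousAt (fun s : ℝ => -((1 - 2 * s * Complex.I) / (1 + 2 * s * Complex.I))) 0 := by
    refine ContinuousAt.neg (ContinuousAt.div (by fun_prop) (by fun_prop) (by simp))
  simpa [ContinuousAt] using h

/-- The logarithm of an edge tends to `π i` when the edge is approached from the left. -/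
theorem tendsto_edgeLog_left {a b : Plane} (hab : a ≠ b) :
    Tendsto (fun s : ℝ => edgeLog (a, b) (toC (midpoint ℝ a b + s • leftNormal a b))) (𝓝[>] 0)
      (𝓝 (Real.pi * Complex.I)) := by
  simp_rw [edgeLog_midpoint_add hab]
  have h := Complex.tendsto_log_nhdsWithin_im_nonneg_of_re_neg_of_im_zero
    (z := -1) (by simp) (by simp)
  rw [norm_neg, norm_one, Real.log_one, Complex.ofReal_zero, zero_add] at h
  refine h.comp (tendsto_nhdsWithin_iff.2 ⟨tendsto_neg_div.mono_left nhdsWithin_le_nhds, ?_⟩)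
  filter_upwards [self_mem_nhdsWithin] with s hs
  have hs : 0 < s := hs
  rw [im_neg_div]
  positivity

/-- The logarithm of an edge tends to `-π i` when the edge is approached from the right. -/
theorem tendsto_edgeLog_right {a b : Plane} (hab : a ≠ b) :
    Tendsto (fun s : ℝ => edgeLog (a, b) (toC (midpoint ℝ a b + (-s) • leftNormal a b))) (𝓝[>] 0)
      (𝓝 (-(Real.pi * Complex.I))) := by
  simp_rw [edgeLog_midpoint_add hab]
  have h := Complex.tendsto_log_nhdsWithin_im_neg_of_re_neg_of_im_zero
    (z := -1) (by simp) (by simp)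
  rw [norm_neg, norm_one, Real.log_one, Complex.ofReal_zero, zero_sub] at h
  have hneg : Tendsto (fun s : ℝ => -s) (𝓝[>] 0) (𝓝 0) := by
    simpa using (continuous_neg.tendsto (0 : ℝ)).mono_left nhdsWithin_le_nhds
  refine h.comp (tendsto_nhdsWithin_iff.2 ⟨tendsto_neg_div.comp hneg, ?_⟩)
  filter_upwards [self_mem_nhdsWithin] with s hs
  have hs : 0 < s := hs
  rw [im_neg_div]
  have : 0 < 4 * s / (1 + 4 * (-s) ^ 2) := by positivity
  have e : 4 * -s / (1 + 4 * (-s) ^ 2) = -(4 * s / (1 + 4 * (-s) ^ 2)) := by ring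
  linarith

namespace Mesh

variable {Ω : Set Plane} (M : Mesh Ω)

/-- The edges of a mesh do not meet the open triangles. -/
theorem notMem_segment_of_mem_openTriangle {T T' : Finset Plane} (hT : T ∈ M.triangles)
    (hT' : T' ∈ M.triangles) {x : Plane} (hx : x ∈ openTriangle T) {e : Plane × Plane}
    (he : e ∈ leftEdges T') : x ∉ segment ℝ e.1 e.2 := by
  intro hxe
  rw [mem_leftEdges] at he
  have hface := (M.pair_mem_edges hT' he.1 he.2.1 he.ne).1
  obtain ⟨a, b, c, h, rfl⟩ := M.exists_vertices hT
  have hxi := M.region_inter_subset (M.mem_triangles.1 hT).1 hface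
    ⟨openTriangle_subset_region h hx, by rwa [region, Finset.coe_pair, convexHull_pair]⟩
  rw [mem_openTriangle h] at hx
  have hcard : (({a, b, c} : Finset Plane) ∩ {e.1, e.2}).card ≤ 2 :=
    (Finset.card_le_card Finset.inter_subset_right).trans Finset.card_le_two
  -- some vertex of the triangle is not an end point of the edge, so that `x` would lie on the side
  -- opposite to that vertex
  have aux {p q : Plane}
      (hs : ((({a, b, c} : Finset Plane) ∩ {e.1, e.2} : Finset Plane) : Set Plane) ⊆ {p, q}) :
      cross p q x = 0 := by
    refine cross_eq_zero_of_mem_segment ?_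
    rw [← convexHull_pair]
    exact convexHull_mono hs hxi
  obtain ⟨y, hy, hyn⟩ : ∃ y ∈ ({a, b, c} : Finset Plane), y ∉ ({e.1, e.2} : Finset Plane) := by
    by_contra hcon
    push Not at hcon
    rw [Finset.inter_eq_left.2 hcon, (M.mem_triangles.1 hT).2] at hcard
    omega
  have hs {z : Plane} (hz : z ∈ (({a, b, c} : Finset Plane) ∩ {e.1, e.2} : Finset Plane)) :
      (z = a ∨ z = b ∨ z = c) ∧ z ≠ y := by
    rw [Finset.mem_inter] at hz
    exact ⟨by simpa using hz.1, fun h => hyn (h ▸ hz.2)⟩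
  simp only [Finset.mem_insert, Finset.mem_singleton] at hy
  rcases hy with rfl | rfl | rfl
  · exact hx.2.1.ne' (aux fun z hz => by have := hs hz; simp; tauto)
  · exact hx.2.2.ne' (aux fun z hz => by have := hs hz; simp; tauto)
  · exact hx.1.ne' (aux fun z hz => by have := hs hz; simp; tauto)

/-- The midpoint of an edge does not lie on another edge. -/
theorem midpoint_notMem_segment {T T' : Finset Plane} (hT : T ∈ M.triangles)
    (hT' : T' ∈ M.triangles) {e e' : Plane × Plane} (he : e ∈ leftEdges T) (he' : e' ∈ leftEdges T')
    (hne : e' ≠ e) (hne' : e' ≠ e.swap) : midpoint ℝ e.1 e.2 ∉ segment ℝ e'.1 e'.2 := by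
  intro hm
  obtain ⟨a, b⟩ := e
  obtain ⟨a', b'⟩ := e'
  rw [mem_leftEdges] at he he'
  have hab : a ≠ b := he.ne
  have hab' : a' ≠ b' := he'.ne
  have hx := M.region_inter_subset (M.pair_mem_edges hT he.1 he.2.1 he.ne).1
    (M.pair_mem_edges hT' he'.1 he'.2.1 he'.ne).1
    ⟨by rw [region, Finset.coe_pair, convexHull_pair]; exact midpoint_mem_segment _ _,
      by rwa [region, Finset.coe_pair, convexHull_pair]⟩
  have hma : midpoint ℝ a b ≠ a := by simpa [midpoint_eq_left_iff] using hab
  have hmb : midpoint ℝ a b ≠ b := by simpa [midpoint_eq_right_iff] using hab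
  have aux {p : Plane} (hs : (({a, b} : Finset Plane) ∩ {a', b'}) ⊆ {p}) : midpoint ℝ a b = p := by
    have := convexHull_mono (𝕜 := ℝ) (Finset.coe_subset.2 hs) hx
    simpa using this
  have hmem (z : Plane) : z ∈ (({a, b} : Finset Plane) ∩ {a', b'}) ↔
      (z = a ∨ z = b) ∧ (z = a' ∨ z = b') := by simp
  simp only [ne_eq, Prod.swap_prod_mk, Prod.mk.injEq] at hne hne'
  by_cases h1 : a = a' ∨ a = b'
  · refine hma (aux fun z hz => ?_)
    rw [hmem] at hz
    rw [Finset.mem_singleton]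
    by_contra hza
    have hzb := hz.1.resolve_left hza
    subst hzb
    rcases h1 with rfl | rfl <;> rcases hz.2 with rfl | rfl <;> simp_all
  · refine hmb (aux fun z hz => ?_)
    rw [hmem] at hz
    rw [Finset.mem_singleton]
    by_contra hzb
    have hza := hz.1.resolve_right hzb
    subst hza
    exact h1 hz.2

/-- A function in the Fortin–Soulie space becomes continuous across the interior edges if suitable
multiples `C T` of the quadratic bubble functions, whose traces on the edges are Legendre polynomials,
are subtracted from it. The jumps form a closed cochain on the dual graph; that it is exact is a
statement about planar topology, proved here without any: the constants are the values on the
triangles of the sum of the angles at which the edges are seen, weighted by the jumps. -/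
theorem exists_constants (hΩ : IsOpen Ω) {f : Broken M} (hf : f ∈ fortinSoulie M) :
    ∃ C : M.triangles → ℝ, ∀ (T T' : M.triangles) (a b : Plane), {a, b} ∈ M.interiorEdges →
      IsLeft T.1 a b → IsLeft T'.1 b a →
      C T - C T' = legendreCoeff (f T) (a, b) - legendreCoeff (f T') (b, a) := by
  obtain ⟨-, hint, hbd⟩ := hf
  let Φ : ℂ → ℂ := fun w => ∑ T : M.triangles, ∑ e ∈ leftEdges T.1,
    (legendreCoeff (f T) e : ℂ) * edgeLog e w
  -- `Φ` has derivative zero off the edges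
  have hderiv (T : M.triangles) (x : Plane) (hx : x ∈ openTriangle T.1) :
      HasDerivAt Φ 0 (toC x) := by
    have h1 : HasDerivAt Φ (∑ T : M.triangles, ∑ e ∈ leftEdges T.1,
        (legendreCoeff (f T) e : ℂ) * ((toC e.1 - toC x)⁻¹ - (toC e.2 - toC x)⁻¹)) (toC x) := by
      refine HasDerivAt.fun_sum fun T' _ => HasDerivAt.fun_sum fun e he => ?_
      exact (hasDerivAt_edgeLog
        (M.notMem_segment_of_mem_openTriangle T.2 T'.2 hx he)).const_mul _
    refine h1.congr_deriv ?_
    -- the vertex values telescope in each triangle, the remainders cancel along each edge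
    have h2 : ∑ T : M.triangles, ∑ e ∈ leftEdges T.1,
        ((evalAt e.1 (f T) : ℂ) * (toC e.1 - toC x)⁻¹ -
          (evalAt e.2 (f T) : ℂ) * (toC e.2 - toC x)⁻¹) = 0 := by
      refine Finset.sum_eq_zero fun T' _ => ?_
      obtain ⟨a, b, c, h, hT⟩ := M.exists_vertices T'.2
      rw [hT, sum_leftEdges h]
      ring
    have h3 := M.sum_leftEdges_eq_zero hΩ (A := ℂ) (fun T e =>
      ((legendreCoeff (f T) e - evalAt e.1 (f T) : ℝ) : ℂ) * (toC e.1 - toC x)⁻¹ -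
        ((legendreCoeff (f T) e - evalAt e.2 (f T) : ℝ) : ℂ) * (toC e.2 - toC x)⁻¹) ?_ ?_
    · have h4 := congrArg₂ (· + ·) h2 h3
      simp only [← Finset.sum_add_distrib, add_zero] at h4
      rw [← h4]
      refine Finset.sum_congr rfl fun _ _ => Finset.sum_congr rfl fun _ _ => ?_
      push_cast
      ring
    · intro T T' a b he h h'
      obtain ⟨k1, k2⟩ := (hint a b he h.ne T T' h.1 h.2.1 h'.2.1 h'.1).legendreCoeff_eq
      have e1 : legendreCoeff (f T) (a, b) - evalAt a (f T) =
        legendreCoeff (f T') (b, a) - evalAt a (f T') := by linarith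
      have e2 : legendreCoeff (f T) (a, b) - evalAt b (f T) =
        legendreCoeff (f T') (b, a) - evalAt b (f T') := by linarith
      simp only [e1, e2]
      ring
    · intro T a b he h
      obtain ⟨k1, k2⟩ := (hbd a b he h.ne T h.1 h.2.1).legendreCoeff_eq'
      have e1 : legendreCoeff (f T) (a, b) - evalAt a (f T) = 0 := by linarith
      have e2 : legendreCoeff (f T) (a, b) - evalAt b (f T) = 0 := by linarith
      simp [e1, e2]
  -- hence it is constant on each triangle
  have hconst (T : M.triangles) : ∃ c : ℂ, ∀ x ∈ openTriangle T.1, Φ (toC x) = c := by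
    have ho : IsOpen (toC '' openTriangle T.1) :=
      toC.toHomeomorph.isOpenMap _ (isOpen_openTriangle T.1)
    have hc : Convex ℝ (toC '' openTriangle T.1) :=
      (convex_openTriangle T.1).is_linear_image toC.toLinearEquiv.toLinearMap.isLinear
    obtain ⟨c, h⟩ := ho.exists_is_const_of_deriv_eq_zero hc.isPreconnected (f := Φ)
      (by
        rintro _ ⟨x, hx, rfl⟩
        exact (hderiv T x hx).differentiableAt.differentiableWithinAt)
      (by
        rintro _ ⟨x, hx, rfl⟩
        exact (hderiv T x hx).deriv)
    exact ⟨c, fun x hx => h _ ⟨x, hx, rfl⟩⟩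
  choose c hc using hconst
  refine ⟨fun T => (c T).im / (2 * Real.pi), fun T T' a b he h h' => ?_⟩
  have hab := h.ne
  -- the jump of `Φ` across the edge `ab`
  let m := midpoint ℝ a b
  let v := leftNormal a b
  let ℓ : M.triangles → Plane × Plane → ℂ := fun S e =>
    if e = (a, b) then (legendreCoeff (f S) e : ℂ) * (2 * Real.pi * Complex.I)
    else if e = (b, a) then (legendreCoeff (f S) e : ℂ) * -(2 * Real.pi * Complex.I) else 0
  have hlim : Tendsto (fun s : ℝ => Φ (toC (m + s • v)) - Φ (toC (m + (-s) • v))) (𝓝[>] 0)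
      (𝓝 (∑ S : M.triangles, ∑ e ∈ leftEdges S.1, ℓ S e)) := by
    simp only [Φ, ← Finset.sum_sub_distrib]
    refine tendsto_finsetSum _ fun S _ => tendsto_finsetSum _ fun e heS => ?_
    simp_rw [← mul_sub]
    simp only [ℓ]
    split_ifs with h1 h2
    · subst h1
      have := ((tendsto_edgeLog_left hab).sub (tendsto_edgeLog_right hab)).const_mul
        (legendreCoeff (f S) (a, b) : ℂ)
      convert this using 2
      ring
    · subst h2
      have := ((tendsto_edgeLog_right hab.symm).sub (tendsto_edgeLog_left hab.symm)).const_mul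
        (legendreCoeff (f S) (b, a) : ℂ)
      simp only [leftNormal_swap a b, midpoint_comm b a, smul_neg, neg_smul, neg_neg] at this
      simp only [neg_smul]
      convert this using 2
      ring
    · have hseg := M.midpoint_notMem_segment T.2 S.2 (mem_leftEdges.2 h : (a, b) ∈ _) heS h1 h2
      have hcont : ContinuousAt (edgeLog e) (toC m) := (hasDerivAt_edgeLog hseg).continuousAt
      have hp : Tendsto (fun s : ℝ => toC (m + s • v)) (𝓝 0) (𝓝 (toC m)) := by
        have : Continuous fun s : ℝ => toC (m + s • v) := toC.continuous.comp (by fun_prop)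
        simpa using this.tendsto 0
      have hneg : Tendsto (fun s : ℝ => -s) (𝓝 0) (𝓝 0) := by
        simpa using (continuous_neg.tendsto (0 : ℝ))
      have := (((hcont.tendsto.comp hp).sub (hcont.tendsto.comp (hp.comp hneg))).const_mul
        (legendreCoeff (f S) e : ℂ)).mono_left (nhdsWithin_le_nhds (s := Set.Ioi 0))
      simpa using this
  have hev : ∀ᶠ s : ℝ in 𝓝[>] 0, Φ (toC (m + s • v)) - Φ (toC (m + (-s) • v)) = c T - c T' := by
    obtain ⟨p, hp, hT⟩ := M.exists_apex T.2 h
    obtain ⟨p', hp', hT'⟩ := M.exists_apex T'.2 h'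
    have h1 := eventually_mem_openTriangle hp (cross_midpoint_add_leftNormal_pos hab)
    have h2 := eventually_mem_openTriangle hp' (cross_midpoint_add_leftNormal_pos hab.symm)
    rw [← hT] at h1
    rw [← hT', leftNormal_swap, midpoint_comm] at h2
    filter_upwards [h1, h2] with s hs1 hs2
    rw [hc T _ hs1, hc T' _ (by simpa using hs2)]
  have heq : c T - c T' = ∑ S : M.triangles, ∑ e ∈ leftEdges S.1, ℓ S e :=
    tendsto_nhds_unique (tendsto_const_nhds.congr' (hev.mono fun _ h => h.symm)) hlim
  have hsum : ∑ S : M.triangles, ∑ e ∈ leftEdges S.1, ℓ S e =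
      ((legendreCoeff (f T) (a, b) - legendreCoeff (f T') (b, a) : ℝ) : ℂ) *
        (2 * Real.pi * Complex.I) := by
    have hne : ((a, b) : Plane × Plane) ≠ (b, a) := by simp [hab]
    have hsplit (S : M.triangles) (e : Plane × Plane) : ℓ S e =
        (if e = (a, b) then (legendreCoeff (f S) (a, b) : ℂ) * (2 * Real.pi * Complex.I) else 0) -
        if e = (b, a) then (legendreCoeff (f S) (b, a) : ℂ) * (2 * Real.pi * Complex.I) else 0 := by
      simp only [ℓ]
      split_ifs with h1 h2 h2
      · exact absurd (h1.symm.trans h2) hne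
      · rw [h1, sub_zero]
      · rw [h2]; ring
      · simp
    have hpick {T₀ : M.triangles} {p q : Plane} (h₀ : IsLeft T₀.1 p q) (k : M.triangles → ℂ) :
        ∑ S : M.triangles, ∑ e ∈ leftEdges S.1, (if e = (p, q) then k S else 0) = k T₀ := by
      simp_rw [Finset.sum_ite_eq', mem_leftEdges]
      rw [Finset.sum_eq_single T₀, if_pos h₀]
      · intro S _ hS
        exact if_neg fun h => hS (Subtype.ext (M.isLeft_unique S.2 T₀.2 h h₀))
      · simp
    simp_rw [hsplit, Finset.sum_sub_distrib]
    rw [hpick h (fun S => (legendreCoeff (f S) (a, b) : ℂ) * (2 * Real.pi * Complex.I)),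
      hpick h' (fun S => (legendreCoeff (f S) (b, a) : ℂ) * (2 * Real.pi * Complex.I))]
    push_cast
    ring
  have him := congrArg Complex.im (heq.trans hsum)
  rw [← sub_div, ← Complex.sub_im, him, div_eq_iff (by positivity)]
  simp

/-! ### Jacobians of functions in the Fortin–Soulie space -/

/-- The integral of the Jacobian determinant as a sum over the oriented edges of the triangle. -/
theorem setIntegral_jacobian_eq_sum {T : Finset Plane} (hT : T ∈ M.triangles) (f g : Poly) :
    ∫ x in region T, evalAt x (jacobian f g) = ∑ e ∈ leftEdges T, lineForm f g e.1 e.2 := by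
  obtain ⟨a, b, c, h, rfl⟩ := M.exists_vertices hT
  rw [sum_leftEdges h, region_eq, setIntegral_jacobian h]

/-- The integrals of the Jacobian determinant of two functions in the Fortin–Soulie space sum up to
zero, as for functions in `H¹₀`. -/
theorem sum_setIntegral_jacobian_eq_zero (hΩ : IsOpen Ω) {f g : Broken M}
    (hf : f ∈ fortinSoulie M) (hg : g ∈ fortinSoulie M) :
    ∑ T : M.triangles, ∫ x in region T.1, evalAt x (jacobian (f T) (g T)) = 0 := by
  obtain ⟨C, hC⟩ := M.exists_constants hΩ hg
  obtain ⟨hf1, hf2, hf3⟩ := hf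
  obtain ⟨hg1, hg2, hg3⟩ := hg
  simp_rw [fun T : M.triangles => M.setIntegral_jacobian_eq_sum T.2]
  -- subtracting the constants, which telescope in each triangle, makes the edge terms cancel
  have h1 : ∑ T : M.triangles, ∑ e ∈ leftEdges T.1,
      C T * (evalAt e.2 (f T) - evalAt e.1 (f T)) = 0 := by
    refine Finset.sum_eq_zero fun T _ => ?_
    obtain ⟨a, b, c, h, hT⟩ := M.exists_vertices T.2
    rw [hT, sum_leftEdges h]
    ring
  have h2 := M.sum_leftEdges_eq_zero hΩ (A := ℝ) (fun T e =>
    lineForm (f T) (g T) e.1 e.2 - C T * (evalAt e.2 (f T) - evalAt e.1 (f T))) ?_ ?_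
  · simpa only [Finset.sum_sub_distrib, h1, sub_zero] using h2
  · intro T T' a b he h h'
    obtain ⟨p1, p2⟩ := hf2 a b he h.ne T T' h.1 h.2.1 h'.2.1 h'.1
    obtain ⟨q1, q2⟩ := hg2 a b he h.ne T T' h.1 h.2.1 h'.2.1 h'.1
    have hc := hC T T' a b he h h'
    rw [evalAt_sub, evalAt_sub] at p1 p2 q1 q2
    simp only [legendreCoeff, midpoint_comm b a] at hc
    simp only [lineForm_eq _ _ (hf1 _) (hg1 _), midpoint_comm b a]
    have f2 : evalAt b (f T') = evalAt b (f T) - (evalAt a (f T) - evalAt a (f T')) := by linarith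
    have f3 : evalAt (midpoint ℝ a b) (f T') =
      evalAt (midpoint ℝ a b) (f T) + (evalAt a (f T) - evalAt a (f T')) / 2 := by linarith
    have g2 : evalAt b (g T') = evalAt b (g T) - (evalAt a (g T) - evalAt a (g T')) := by linarith
    have g3 : evalAt (midpoint ℝ a b) (g T') =
      evalAt (midpoint ℝ a b) (g T) + (evalAt a (g T) - evalAt a (g T')) / 2 := by linarith
    have hC' : C T' = C T - (evalAt a (g T) - evalAt a (g T')) := by linarith
    rw [hC', f2, f3, g2, g3]
    ring
  · intro T a b he h
    obtain ⟨p1, p2⟩ := hf3 a b he h.ne T h.1 h.2.1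
    obtain ⟨q1, q2⟩ := hg3 a b he h.ne T h.1 h.2.1
    simp only [lineForm_eq _ _ (hf1 _) (hg1 _), p2, q2, ← p1, ← q1]
    ring

/-- Piecewise constants without jumps across the interior edges that vanish at the boundary edges are
zero. -/
theorem eq_zero_of_no_jumps (hΩ : IsOpen Ω) (k : M.triangles → ℝ)
    (hint : ∀ (T T' : M.triangles) (a b : Plane), {a, b} ∈ M.interiorEdges → IsLeft T.1 a b →
      IsLeft T'.1 b a → k T = k T')
    (hbd : ∀ (T : M.triangles) (a b : Plane), {a, b} ∈ M.boundaryEdges → IsLeft T.1 a b → k T = 0)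
    (T : M.triangles) : k T = 0 := by
  -- the areas of the triangles are sums over their edges
  have harea (T : M.triangles) :
      0 < ∑ e ∈ leftEdges T.1, (e.1 0 * e.2 1 - e.1 1 * e.2 0) := by
    obtain ⟨a, b, c, h, hT⟩ := M.exists_vertices T.2
    rw [hT, sum_leftEdges h]
    unfold cross at h
    linarith
  have h := M.sum_leftEdges_eq_zero hΩ (A := ℝ)
    (fun T e => k T ^ 2 * (e.1 0 * e.2 1 - e.1 1 * e.2 0)) ?_ ?_
  · simp_rw [← Finset.mul_sum] at h
    have h' := (Finset.sum_eq_zero_iff_of_nonneg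
      (fun T _ => mul_nonneg (sq_nonneg (k T)) (harea T).le)).1 h T (Finset.mem_univ T)
    exact pow_eq_zero_iff two_ne_zero |>.1 ((mul_eq_zero.1 h').resolve_right (harea T).ne')
  · intro T T' a b he h h'
    simp only [hint T T' a b he h h']
    ring
  · intro T a b he h
    simp only [hbd T a b he h]
    ring

end Mesh

/-! ### Pointwise identities -/

/-- The divergence of a polynomial vector field. -/
def divergence (u : Fin 2 → Poly) : Poly := pderiv 0 (u 0) + pderiv 1 (u 1)

/-- The rotation of a polynomial vector field (with the sign for which
`Δu - ∇ div u = (∂₂ rot u, -∂₁ rot u)`). -/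
def rotation (u : Fin 2 → Poly) : Poly := pderiv 1 (u 0) - pderiv 0 (u 1)

theorem divStress_eq (μ lam : ℝ) (u : Fin 2 → Poly) (i : Fin 2) :
    divStress μ lam u i = μ • laplacian (u i) + (μ + lam) • pderiv i (divergence u) := by
  fin_cases i <;>
    simp [divStress, stress, strain, dispGradient, laplacian, divergence, Fin.sum_univ_two,
      Matrix.trace, Matrix.one_apply, pderiv_comm 1 0] <;>
    module

/-- The square of `∇·σ(u)`, up to a null Lagrangian. -/
theorem sum_evalAt_divStress_sq (μ lam : ℝ) (u : Fin 2 → Poly) (x : Plane) :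
    ∑ i, evalAt x (divStress μ lam u i) ^ 2 =
      μ ^ 2 * ∑ i, evalAt x (laplacian (u i)) ^ 2 +
      (2 * μ * (μ + lam) + (μ + lam) ^ 2) * ∑ i, evalAt x (pderiv i (divergence u)) ^ 2 +
      2 * μ * (μ + lam) * evalAt x (jacobian (divergence u) (rotation u)) := by
  simp_rw [divStress_eq]
  simp only [Fin.sum_univ_two, laplacian, jacobian, divergence, rotation, evalAt_add, evalAt_sub,
    evalAt_mul, evalAt_smul, map_add, map_sub, pderiv_comm 1 0]
  ring

/-- The square of the Hessian, up to a null Lagrangian. -/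
theorem sum_evalAt_hessian_sq (p : Poly) (x : Plane) :
    ∑ j, ∑ k, evalAt x (pderiv j (pderiv k p)) ^ 2 =
      evalAt x (laplacian p) ^ 2 - 2 * evalAt x (jacobian (pderiv 0 p) (pderiv 1 p)) := by
  simp only [Fin.sum_univ_two, laplacian, jacobian, evalAt_add, evalAt_sub, evalAt_mul,
    pderiv_comm 1 0]
  ring

/-! ### Energy identities -/

theorem isCompact_region (T : Finset Plane) : IsCompact (region T) :=
  T.finite_toSet.isCompact_convexHull ℝ

theorem integrableOn_region {F : Plane → ℝ} (hF : Continuous F) (T : Finset Plane) :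
    IntegrableOn F (region T) :=
  hF.continuousOn.integrableOn_compact (isCompact_region T)

theorem energyNorm_sq {Ω : Set Plane} {M : Mesh Ω} (μ lam : ℝ) (w : VB30 M) :
    energyNorm μ lam w ^ 2 = ∑ T : M.triangles, ∫ x in region T.1,
      ∑ i, evalAt x (divStress μ lam (w.on T) i) ^ 2 :=
  Real.sq_sqrt (Finset.sum_nonneg fun _ _ => integral_nonneg fun _ =>
    Finset.sum_nonneg fun _ _ => sq_nonneg _)

theorem laplaceNorm_sq {Ω : Set Plane} {M : Mesh Ω} (w : VB30 M) :
    laplaceNorm w ^ 2 = ∑ T : M.triangles, ∫ x in region T.1,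
      ∑ i, evalAt x (laplacian (w.on T i)) ^ 2 :=
  Real.sq_sqrt (Finset.sum_nonneg fun _ _ => integral_nonneg fun _ =>
    Finset.sum_nonneg fun _ _ => sq_nonneg _)

theorem hessianNorm_sq {Ω : Set Plane} {M : Mesh Ω} (w : VB30 M) :
    hessianNorm w ^ 2 = ∑ T : M.triangles, ∫ x in region T.1,
      ∑ i, ∑ j, ∑ k, evalAt x (pderiv j (pderiv k (w.on T i))) ^ 2 :=
  Real.sq_sqrt (Finset.sum_nonneg fun _ _ => integral_nonneg fun _ =>
    Finset.sum_nonneg fun _ _ => Finset.sum_nonneg fun _ _ => Finset.sum_nonneg fun _ _ =>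
      sq_nonneg _)

section

variable {Ω : Set Plane} {M : Mesh Ω}

theorem hessianNorm_sq_eq (hΩ : IsOpen Ω) (w : VB30 M) :
    hessianNorm w ^ 2 = laplaceNorm w ^ 2 := by
  rw [hessianNorm_sq, laplaceNorm_sq]
  have hJ (i : Fin 2) : ∑ T : M.triangles, ∫ x in region T.1,
      evalAt x (jacobian (pderiv 0 (w.on T i)) (pderiv 1 (w.on T i))) = 0 :=
    M.sum_setIntegral_jacobian_eq_zero hΩ (pderiv_mem_fortinSoulie (w i).2 0)
      (pderiv_mem_fortinSoulie (w i).2 1)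
  have hT (T : M.triangles) :
      ∫ x in region T.1, ∑ i, ∑ j, ∑ k, evalAt x (pderiv j (pderiv k (w.on T i))) ^ 2 =
      (∫ x in region T.1, ∑ i, evalAt x (laplacian (w.on T i)) ^ 2) -
        2 * ∑ i, ∫ x in region T.1,
          evalAt x (jacobian (pderiv 0 (w.on T i)) (pderiv 1 (w.on T i))) := by
    simp_rw [sum_evalAt_hessian_sq, Finset.sum_sub_distrib, ← Finset.mul_sum]
    rw [← integral_finsetSum _ (fun i _ => integrableOn_region (continuous_evalAt _) _),
      ← integral_const_mul, ← integral_sub]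
    · exact integrableOn_region (continuous_finsetSum _ fun i _ => (continuous_evalAt _).pow 2) _
    · exact (integrableOn_region (continuous_finsetSum _ fun i _ => continuous_evalAt _) _).const_mul _
  simp_rw [hT]
  rw [Finset.sum_sub_distrib, ← Finset.mul_sum, Finset.sum_comm, Finset.sum_eq_zero fun i _ => hJ i,
    mul_zero, sub_zero]

theorem laplaceNorm_sq_le (hΩ : IsOpen Ω) {μ lam : ℝ} (hμ : 0 < μ) (hlam : 0 < lam) (w : VB30 M) :
    μ ^ 2 * laplaceNorm w ^ 2 ≤ energyNorm μ lam w ^ 2 := by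
  rw [energyNorm_sq, laplaceNorm_sq]
  have hp : (fun T => divergence (w.on T)) ∈ fortinSoulie M :=
    add_mem (pderiv_mem_fortinSoulie (w 0).2 0) (pderiv_mem_fortinSoulie (w 1).2 1)
  have hq : (fun T => rotation (w.on T)) ∈ fortinSoulie M :=
    sub_mem (pderiv_mem_fortinSoulie (w 0).2 1) (pderiv_mem_fortinSoulie (w 1).2 0)
  have hJ := M.sum_setIntegral_jacobian_eq_zero hΩ hp hq
  have hT (T : M.triangles) :
      ∫ x in region T.1, ∑ i, evalAt x (divStress μ lam (w.on T) i) ^ 2 =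
      μ ^ 2 * (∫ x in region T.1, ∑ i, evalAt x (laplacian (w.on T i)) ^ 2) +
      (2 * μ * (μ + lam) + (μ + lam) ^ 2) *
        (∫ x in region T.1, ∑ i, evalAt x (pderiv i (divergence (w.on T))) ^ 2) +
      2 * μ * (μ + lam) *
        ∫ x in region T.1, evalAt x (jacobian (divergence (w.on T)) (rotation (w.on T))) := by
    have h1 (p : Fin 2 → Poly) : IntegrableOn (fun x => ∑ i, evalAt x (p i) ^ 2) (region T.1) :=
      integrableOn_region (continuous_finsetSum _ fun i _ => (continuous_evalAt _).pow 2) _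
    simp_rw [sum_evalAt_divStress_sq]
    rw [integral_add, integral_add, integral_const_mul, integral_const_mul, integral_const_mul]
    · exact (h1 _).const_mul _
    · exact (h1 _).const_mul _
    · exact ((h1 _).const_mul _).add ((h1 _).const_mul _)
    · exact (integrableOn_region (continuous_evalAt _) _).const_mul _
  simp_rw [hT, Finset.sum_add_distrib, ← Finset.mul_sum]
  rw [hJ, mul_zero, add_zero]
  refine le_add_of_nonneg_right (mul_nonneg (by positivity) (Finset.sum_nonneg fun _ _ =>
    integral_nonneg fun _ => Finset.sum_nonneg fun _ _ => sq_nonneg _))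

/-! ### Definiteness -/

/-- A polynomial that vanishes on a nonempty open set is zero. -/
theorem eq_zero_of_isOpen {U : Set Plane} (hU : IsOpen U) (hne : U.Nonempty) {p : Poly}
    (h : ∀ x ∈ U, evalAt x p = 0) : p = 0 := by
  obtain ⟨x, hx⟩ := hne
  have hV : IsOpen ((WithLp.toLp 2 : (Fin 2 → ℝ) → Plane) ⁻¹' U) :=
    hU.preimage (PiLp.continuous_toLp 2 _)
  obtain ⟨r, hr, hball⟩ := Metric.isOpen_iff.1 hV (WithLp.ofLp x) hx
  refine MvPolynomial.funext_set (fun i => Metric.ball (x i) r) (fun i => ?_) fun y hy => ?_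
  · rw [Real.ball_eq_Ioo]
    exact Set.Ioo_infinite (by linarith)
  · rw [← ball_pi _ hr] at hy
    simpa [evalAt] using h _ (hball hy)

theorem evalAt_eq_of_pderiv_eq_zero {p : Poly} (h : ∀ i, pderiv i p = 0) (x : Plane) :
    evalAt x p = evalAt 0 p := by
  have hd (t : ℝ) := hasDerivAt_evalAt_line 0 x p t
  have h0 : dirDeriv x p = 0 := by simp [dirDeriv_apply, h]
  have := is_const_of_deriv_eq_zero (fun t => (hd t).differentiableAt)
    (fun t => by rw [(hd t).deriv, h0, evalAt_zero]) 1 0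
  simpa using this

theorem Mesh.openTriangle_nonempty {T : Finset Plane} (hT : T ∈ M.triangles) :
    (openTriangle T).Nonempty := by
  obtain ⟨a, b, c, h, rfl⟩ := M.exists_vertices hT
  obtain ⟨s, hs⟩ := (eventually_mem_openTriangle h
    (cross_midpoint_add_leftNormal_pos (ne_of_cross_pos h).1)).exists
  exact ⟨_, hs⟩

/-- A piecewise affine function in `B³_{h0}` is zero. -/
theorem eq_zero_of_hessian_eq_zero (hΩ : IsOpen Ω) {v : Broken M} (hv : v ∈ B30 M)
    (h : ∀ T j k, pderiv j (pderiv k (v T)) = 0) : v = 0 := by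
  -- the gradient is piecewise constant, and its jumps vanish as they have mean zero
  have h1 (i : Fin 2) (T : M.triangles) (x : Plane) : evalAt x (pderiv i (v T)) = 0 := by
    obtain ⟨-, hint, hbd⟩ := pderiv_mem_fortinSoulie hv i
    have hc (T : M.triangles) (x : Plane) :
        evalAt x (pderiv i (v T)) = evalAt 0 (pderiv i (v T)) :=
      evalAt_eq_of_pderiv_eq_zero (fun j => h T j i) x
    rw [hc]
    refine M.eq_zero_of_no_jumps hΩ (fun T => evalAt 0 (pderiv i (v T))) ?_ ?_ T
    · intro T T' a b he k k'
      have := (hint a b he k.ne T T' k.1 k.2.1 k'.2.1 k'.1).2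
      rw [evalAt_sub, evalAt_sub, hc, hc T', hc T a, hc T' a] at this
      linarith
    · intro T a b he k
      have := (hbd a b he k.ne T k.1 k.2.1).2
      rw [hc, hc T a] at this
      linarith
  have h2 (T : M.triangles) (i : Fin 2) : pderiv i (v T) = 0 :=
    eq_zero_of_isOpen isOpen_univ Set.univ_nonempty fun x _ => h1 i T x
  have hc (T : M.triangles) (x : Plane) : evalAt x (v T) = evalAt 0 (v T) :=
    evalAt_eq_of_pderiv_eq_zero (h2 T) x
  obtain ⟨⟨-, hvert, -⟩, hvert0, -⟩ := hv
  funext T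
  refine eq_zero_of_isOpen isOpen_univ Set.univ_nonempty fun x _ => ?_
  rw [hc]
  refine M.eq_zero_of_no_jumps hΩ (fun T => evalAt 0 (v T)) ?_ ?_ T
  · intro T T' a b he k k'
    simpa only [hc T a, hc T' a] using hvert T T' a k.1 k'.2.1
  · intro T a b he k
    simpa only [hc T a] using hvert0 T a k.1 (M.mem_frontier_of_boundaryEdge he)

theorem eq_zero_of_energyNorm_eq_zero (hΩ : IsOpen Ω) {μ lam : ℝ} (hμ : 0 < μ) (hlam : 0 < lam)
    {w : VB30 M} (h : energyNorm μ lam w = 0) : w = 0 := by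
  have h0 : hessianNorm w ^ 2 = 0 := by
    have h1 := laplaceNorm_sq_le hΩ hμ hlam w
    rw [h, ← hessianNorm_sq_eq hΩ] at h1
    have h2 : 0 < μ ^ 2 := by positivity
    nlinarith [sq_nonneg (hessianNorm w)]
  rw [hessianNorm_sq, Finset.sum_eq_zero_iff_of_nonneg (fun _ _ => integral_nonneg fun _ =>
    Finset.sum_nonneg fun _ _ => Finset.sum_nonneg fun _ _ => Finset.sum_nonneg fun _ _ =>
      sq_nonneg _)] at h0
  funext i
  refine Subtype.ext (eq_zero_of_hessian_eq_zero hΩ (w i).2 fun T j k => ?_)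
  let F : Plane → ℝ := fun x => ∑ i, ∑ j, ∑ k, evalAt x (pderiv j (pderiv k (w.on T i))) ^ 2
  have hFc : Continuous F := continuous_finsetSum _ fun i _ => continuous_finsetSum _ fun j _ =>
    continuous_finsetSum _ fun k _ => (continuous_evalAt _).pow 2
  have hF : F =ᵐ[volume.restrict (region T.1)] 0 :=
    (integral_eq_zero_iff_of_nonneg (fun _ => Finset.sum_nonneg fun _ _ =>
      Finset.sum_nonneg fun _ _ => Finset.sum_nonneg fun _ _ => sq_nonneg _)
      (integrableOn_region hFc _)).1 (h0 T (Finset.mem_univ T))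
  have hsub : openTriangle T.1 ⊆ region T.1 := by
    obtain ⟨a, b, c, h, hT⟩ := M.exists_vertices T.2
    rw [hT]
    exact openTriangle_subset_region h
  have hE := Measure.eqOn_open_of_ae_eq (ae_restrict_of_ae_restrict_of_subset hsub hF)
    (isOpen_openTriangle T.1) hFc.continuousOn continuousOn_const
  refine eq_zero_of_isOpen (isOpen_openTriangle T.1) (M.openTriangle_nonempty T.2) fun x hx => ?_
  have h1 := hE hx
  simp only [F, Pi.zero_apply] at h1
  rw [Finset.sum_eq_zero_iff_of_nonneg fun _ _ => Finset.sum_nonneg fun _ _ =>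
    Finset.sum_nonneg fun _ _ => sq_nonneg _] at h1
  have h2 := h1 i (Finset.mem_univ i)
  rw [Finset.sum_eq_zero_iff_of_nonneg fun _ _ => Finset.sum_nonneg fun _ _ => sq_nonneg _] at h2
  have h3 := h2 j (Finset.mem_univ j)
  rw [Finset.sum_eq_zero_iff_of_nonneg fun _ _ => sq_nonneg _] at h3
  exact pow_eq_zero_iff two_ne_zero |>.1 (h3 k (Finset.mem_univ k))

end

/-! ### Forms on finite-dimensional spaces -/

theorem _root_.LinearMap.BilinForm.bijective_of_definite {V : Type*} [AddCommGroup V] [Module ℝ V]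
    [FiniteDimensional ℝ V] (B : LinearMap.BilinForm ℝ V) (hB : ∀ v, B v v = 0 → v = 0) :
    Function.Bijective B := by
  have hinj : Function.Injective B := by
    rw [← LinearMap.ker_eq_bot, LinearMap.ker_eq_bot']
    intro v hv
    exact hB v (by rw [hv, LinearMap.zero_apply])
  exact ⟨hinj, (LinearMap.injective_iff_surjective_of_finrank_eq_finrank
    Subspace.dual_finrank_eq.symm).1 hinj⟩

/-- The Cauchy–Schwarz inequality for real vector-valued square integrable functions. -/
theorem abs_integral_sum_mul_le {α : Type*} [MeasurableSpace α] {ν : Measure α} {ι : Type*}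
    [Fintype ι] {f g : ι → α → ℝ} (hf : ∀ i, MemLp (f i) 2 ν) (hg : ∀ i, MemLp (g i) 2 ν) :
    |∫ x, ∑ i, f i x * g i x ∂ν| ≤
      Real.sqrt (∫ x, ∑ i, f i x ^ 2 ∂ν) * Real.sqrt (∫ x, ∑ i, g i x ^ 2 ∂ν) := by
  have hff : Integrable (fun x => ∑ i, f i x ^ 2) ν :=
    integrable_finsetSum _ fun i _ => (hf i).integrable_sq
  have hgg : Integrable (fun x => ∑ i, g i x ^ 2) ν :=
    integrable_finsetSum _ fun i _ => (hg i).integrable_sq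
  have hfg : Integrable (fun x => ∑ i, f i x * g i x) ν :=
    integrable_finsetSum _ fun i _ => (hf i).integrable_mul (hg i)
  have h := discrim_le_zero (a := ∫ x, ∑ i, f i x ^ 2 ∂ν) (b := 2 * ∫ x, ∑ i, f i x * g i x ∂ν)
    (c := ∫ x, ∑ i, g i x ^ 2 ∂ν) fun s => by
      have e : (fun x => ∑ i, (s * f i x + g i x) ^ 2) = fun x =>
          (s * s) * ∑ i, f i x ^ 2 + (2 * s) * ∑ i, f i x * g i x + ∑ i, g i x ^ 2 := by
        ext x
        simp_rw [Finset.mul_sum, ← Finset.sum_add_distrib]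
        exact Finset.sum_congr rfl fun i _ => by ring
      have h0 : 0 ≤ ∫ x, ∑ i, (s * f i x + g i x) ^ 2 ∂ν :=
        integral_nonneg fun x => Finset.sum_nonneg fun i _ => sq_nonneg _
      rw [e, integral_add (by exact (hff.const_mul _).add (hfg.const_mul _)) hgg,
        integral_add (hff.const_mul _) (hfg.const_mul _), integral_const_mul,
        integral_const_mul] at h0
      linarith
  rw [discrim] at h
  rw [← Real.sqrt_mul (integral_nonneg fun x => Finset.sum_nonneg fun i _ => sq_nonneg _)]
  exact Real.abs_le_sqrt (by linarith)

variable {Ω : Set Plane} {M : Mesh Ω}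

instance : FiniteDimensional ℝ (B30 M) := by
  let φ : B30 M →ₗ[ℝ] (M.triangles → restrictTotalDegree (Fin 2) ℝ 3) :=
    { toFun := fun v T => ⟨v.1 T, (mem_restrictTotalDegree _ _ _).2 (v.2.1.1 T)⟩
      map_add' := fun _ _ => rfl
      map_smul' := fun _ _ => rfl }
  refine FiniteDimensional.of_injective φ fun v w h => Subtype.ext (funext fun T => ?_)
  exact congrArg Subtype.val (congrFun h T)

/-! ### The energy form -/

section energyForm

variable (μ lam : ℝ)

theorem divStress_add (u v : Fin 2 → Poly) (i : Fin 2) :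
    divStress μ lam (u + v) i = divStress μ lam u i + divStress μ lam v i := by
  simp only [divStress_eq, laplacian, divergence, Pi.add_apply, map_add, Finset.sum_add_distrib,
    smul_add]
  abel

theorem divStress_smul (c : ℝ) (u : Fin 2 → Poly) (i : Fin 2) :
    divStress μ lam (c • u) i = c • divStress μ lam u i := by
  simp only [divStress_eq, laplacian, divergence, Pi.smul_apply, Derivation.map_smul,
    ← Finset.smul_sum, ← smul_add, smul_comm _ c]

theorem VB30.on_add (w φ : VB30 M) (T : M.triangles) : (w + φ).on T = w.on T + φ.on T := rfl

theorem VB30.on_smul (c : ℝ) (w : VB30 M) (T : M.triangles) : (c • w).on T = c • w.on T := rfl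

variable {β : Plane → ℝ}

theorem energyForm_symm (w φ : VB30 M) : energyForm μ lam β w φ = energyForm μ lam β φ w := by
  simp only [energyForm, mul_comm (evalAt _ (divStress μ lam (w.on _) _))]

theorem integrableOn_energy (hβ : ∀ T : M.triangles, IntegrableOn β (region T.1)) (w φ : VB30 M)
    (T : M.triangles) : IntegrableOn (fun x => β x * ∑ i, evalAt x (divStress μ lam (w.on T) i) *
      evalAt x (divStress μ lam (φ.on T) i)) (region T.1) :=
  (hβ T).mul_continuousOn (continuous_finsetSum _ fun _ _ =>
    (continuous_evalAt _).mul (continuous_evalAt _)).continuousOn (isCompact_region _)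

theorem energyForm_add (hβ : ∀ T : M.triangles, IntegrableOn β (region T.1)) (w w' φ : VB30 M) :
    energyForm μ lam β (w + w') φ = energyForm μ lam β w φ + energyForm μ lam β w' φ := by
  simp only [energyForm, ← Finset.sum_add_distrib]
  refine Finset.sum_congr rfl fun T _ => ?_
  rw [← integral_add (integrableOn_energy μ lam hβ w φ T) (integrableOn_energy μ lam hβ w' φ T)]
  simp only [VB30.on_add, divStress_add, evalAt_add, add_mul, Finset.sum_add_distrib, mul_add]

theorem energyForm_smul (c : ℝ) (w φ : VB30 M) :
    energyForm μ lam β (c • w) φ = c * energyForm μ lam β w φ := by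
  simp only [energyForm, Finset.mul_sum, ← integral_const_mul]
  refine Finset.sum_congr rfl fun T _ => ?_
  congr 1
  ext x
  simp only [VB30.on_smul, divStress_smul, evalAt_smul, mul_assoc, ← Finset.mul_sum]
  ring

/-- `energyForm` as a bilinear form. -/
def energyBilin (hβ : ∀ T : M.triangles, IntegrableOn β (region T.1)) :
    LinearMap.BilinForm ℝ (VB30 M) :=
  LinearMap.mk₂ ℝ (energyForm μ lam β) (energyForm_add μ lam hβ) (energyForm_smul μ lam)
    (fun w φ φ' => by
      rw [energyForm_symm, energyForm_add μ lam hβ, energyForm_symm, energyForm_symm _ _ φ'])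
    (fun c w φ => by rw [energyForm_symm, energyForm_smul, energyForm_symm, smul_eq_mul])

theorem energyBilin_apply (hβ : ∀ T : M.triangles, IntegrableOn β (region T.1)) (w φ : VB30 M) :
    energyBilin μ lam hβ w φ = energyForm μ lam β w φ := rfl

theorem energyForm_self_nonneg (hβ : ∀ T : M.triangles, ∀ᵐ x ∂volume.restrict (region T.1), 0 ≤ β x)
    (w : VB30 M) : 0 ≤ energyForm μ lam β w w := by
  refine Finset.sum_nonneg fun T _ => integral_nonneg_of_ae ?_
  filter_upwards [hβ T] with x hx
  exact mul_nonneg hx (Finset.sum_nonneg fun i _ => mul_self_nonneg _)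

theorem abs_energyForm_le (hβ : ∀ T : M.triangles, IntegrableOn β (region T.1))
    (hβ0 : ∀ T : M.triangles, ∀ᵐ x ∂volume.restrict (region T.1), 0 ≤ β x) (w φ : VB30 M) :
    |energyForm μ lam β w φ| ≤
      Real.sqrt (energyForm μ lam β w w) * Real.sqrt (energyForm μ lam β φ φ) := by
  rw [← Real.sqrt_mul (energyForm_self_nonneg μ lam hβ0 w)]
  exact Real.abs_le_sqrt ((energyBilin μ lam hβ).apply_sq_le_of_symm
    (energyForm_self_nonneg μ lam hβ0) ⟨energyForm_symm μ lam⟩ w φ)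

theorem energyForm_mono {β γ : Plane → ℝ} (hβ : ∀ T : M.triangles, IntegrableOn β (region T.1))
    (hγ : ∀ T : M.triangles, IntegrableOn γ (region T.1))
    (h : ∀ T : M.triangles, ∀ᵐ x ∂volume.restrict (region T.1), β x ≤ γ x) (w : VB30 M) :
    energyForm μ lam β w w ≤ energyForm μ lam γ w w := by
  refine Finset.sum_le_sum fun T _ => integral_mono_ae (integrableOn_energy μ lam hβ w w T)
    (integrableOn_energy μ lam hγ w w T) ?_
  filter_upwards [h T] with x hx
  exact mul_le_mul_of_nonneg_right hx (Finset.sum_nonneg fun i _ => mul_self_nonneg _)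

theorem energyForm_const (c : ℝ) (w : VB30 M) :
    energyForm μ lam (fun _ => c) w w = c * energyNorm μ lam w ^ 2 := by
  rw [energyNorm_sq, energyForm, Finset.mul_sum]
  refine Finset.sum_congr rfl fun T _ => ?_
  rw [integral_const_mul]
  simp only [pow_two]

theorem integrableOn_const_region (c : ℝ) (T : M.triangles) :
    IntegrableOn (fun _ : Plane => c) (region T.1) :=
  integrableOn_region continuous_const _

theorem abs_energyForm_one_le (w φ : VB30 M) : |energyForm μ lam (fun _ => 1) w φ| ≤
    energyNorm μ lam w * energyNorm μ lam φ := by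
  have h := abs_energyForm_le μ lam (β := fun _ => 1) (integrableOn_const_region (M := M) 1)
    (fun _ => Filter.Eventually.of_forall fun _ => zero_le_one) w φ
  have hn (w : VB30 M) : 0 ≤ energyNorm μ lam w := Real.sqrt_nonneg _
  simpa only [energyForm_const, one_mul, Real.sqrt_sq (hn _)] using h

/-- The energy norm as a seminorm. -/
def energySeminorm (M : Mesh Ω) : Seminorm ℝ (VB30 M) :=
  Seminorm.of (energyNorm μ lam)
    (fun w φ => by
      have hn (w : VB30 M) : 0 ≤ energyNorm μ lam w := Real.sqrt_nonneg _
      refine le_of_sq_le_sq ?_ (add_nonneg (hn w) (hn φ))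
      have hadd := energyForm_add μ lam (integrableOn_const_region (M := M) 1)
      have h := (le_abs_self _).trans (abs_energyForm_one_le μ lam w φ)
      have e := energyForm_const μ lam 1 (w + φ)
      rw [hadd, energyForm_symm, hadd, energyForm_symm μ lam φ (w + φ), hadd,
        energyForm_symm μ lam φ w, energyForm_const, energyForm_const] at e
      nlinarith)
    (fun c w => by
      have hn (w : VB30 M) : 0 ≤ energyNorm μ lam w := Real.sqrt_nonneg _
      have e := energyForm_const μ lam 1 (c • w)
      rw [energyForm_smul, energyForm_symm, energyForm_smul, energyForm_const] at e
      rw [← Real.sqrt_sq (hn (c • w)), ← Real.sqrt_sq (hn w), Real.norm_eq_abs,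
        ← Real.sqrt_sq_eq_abs, ← Real.sqrt_mul (sq_nonneg c)]
      congr 1
      linarith)

end energyForm

/-! ### Coefficients and loads -/

/-- Almost all points of a triangle of the mesh belong to `Ω`. -/
theorem ae_restrict_region (hΩ : Convex ℝ Ω) (T : M.triangles) {P : Plane → Prop}
    (h : ∀ x ∈ Ω, P x) : ∀ᵐ x ∂volume.restrict (region T.1), P x := by
  have hsub : region T.1 ⊆ closure Ω := by
    rw [← M.space_eq]
    exact M.complex.convexHull_subset_space (M.mem_triangles.1 T.2).1
  have hfr : ∀ᵐ x : Plane, x ∉ frontier Ω := measure_eq_zero_iff_ae_notMem.1 (hΩ.addHaar_frontier volume)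
  filter_upwards [ae_restrict_of_ae hfr, ae_restrict_mem (isCompact_region T.1).measurableSet]
    with x hx hxT
  refine h x ?_
  by_contra hn
  exact hx ⟨hsub hxT, fun hi => hn (interior_subset hi)⟩

theorem restrict_region_absolutelyContinuous (hΩ : Convex ℝ Ω) (hΩo : IsOpen Ω) (T : M.triangles) :
    volume.restrict (region T.1) ≪ volume.restrict Ω := by
  intro s hs
  have h1 : ∀ᵐ x ∂volume.restrict Ω, x ∉ s := measure_eq_zero_iff_ae_notMem.1 hs
  rw [ae_restrict_iff' hΩo.measurableSet] at h1
  refine measure_eq_zero_iff_ae_notMem.2 ?_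
  filter_upwards [ae_restrict_of_ae h1, ae_restrict_region hΩ T (P := (· ∈ Ω)) fun _ h => h]
    with x hx hxΩ
  exact hx hxΩ

theorem integrableOn_coefficient (hΩ : Convex ℝ Ω) (hΩo : IsOpen Ω) {β : Plane → ℝ} {m b : ℝ}
    (hm : AEStronglyMeasurable β (volume.restrict Ω)) (hb : ∀ x ∈ Ω, m ≤ β x ∧ β x ≤ b)
    (T : M.triangles) : IntegrableOn β (region T.1) := by
  have hfin : IsFiniteMeasure (volume.restrict (region T.1)) :=
    ⟨by simpa using (isCompact_region T.1).measure_lt_top⟩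
  refine Integrable.of_bound (hm.mono_ac (restrict_region_absolutelyContinuous hΩ hΩo T))
    (max |m| |b|) (ae_restrict_region hΩ T fun x hx => ?_)
  exact abs_le_max_abs_abs (hb x hx).1 (hb x hx).2

theorem memLp_toFun (hΩb : Bornology.IsBounded Ω) (v : Broken M) :
    MemLp v.toFun 2 (volume.restrict Ω) := by
  have hfin : IsFiniteMeasure (volume.restrict Ω) := ⟨by simpa using hΩb.measure_lt_top⟩
  refine memLp_finsetSum _ fun T _ => ?_
  obtain ⟨K, hK⟩ := (isCompact_region T.1).exists_bound_of_continuousOn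
    (continuous_evalAt (v T)).continuousOn
  refine MemLp.of_bound (((continuous_evalAt (v T)).measurable.indicator
    isOpen_interior.measurableSet).aestronglyMeasurable) (max K 0)
    (Filter.Eventually.of_forall fun x => ?_)
  by_cases hx : x ∈ interior (region T.1)
  · rw [Set.indicator_of_mem hx]
    exact (hK x (interior_subset hx)).trans (le_max_left _ _)
  · rw [Set.indicator_of_notMem hx, norm_zero]
    exact le_max_right _ _

theorem toFun_add (v w : Broken M) (x : Plane) :
    Broken.toFun (v + w) x = Broken.toFun v x + Broken.toFun w x := by
  simp only [Broken.toFun, ← Finset.sum_add_distrib, Pi.add_apply, evalAt_add]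
  exact Finset.sum_congr rfl fun T _ => congrFun (Set.indicator_add _ _ _) x

theorem toFun_smul (c : ℝ) (v : Broken M) (x : Plane) :
    Broken.toFun (c • v) x = c * Broken.toFun v x := by
  simp only [Broken.toFun, Finset.mul_sum, Pi.smul_apply, evalAt_smul]
  exact Finset.sum_congr rfl fun T _ => Set.indicator_const_mul _ _ c x

/-- The load as a linear functional. -/
def loadFunctional (hΩb : Bornology.IsBounded Ω) (M : Mesh Ω) {f : Plane → Fin 2 → ℝ}
    (hf : ∀ i, MemLp (fun x => f x i) 2 (volume.restrict Ω)) : VB30 M →ₗ[ℝ] ℝ where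
  toFun := load f
  map_add' φ ψ := by
    have h (φ : VB30 M) : Integrable (fun x => ∑ i, f x i * Broken.toFun (φ i).1 x)
        (volume.restrict Ω) :=
      integrable_finsetSum _ fun i _ => (hf i).integrable_mul (memLp_toFun hΩb _)
    rw [load, load, load, ← integral_add (h φ) (h ψ)]
    simp only [Pi.add_apply, Submodule.coe_add, toFun_add, mul_add, Finset.sum_add_distrib]
  map_smul' c φ := by
    rw [RingHom.id_apply, load, load, smul_eq_mul, ← integral_const_mul]
    simp only [Pi.smul_apply, Submodule.coe_smul, toFun_smul, Finset.mul_sum, mul_left_comm c]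

/-- The load is bounded by the energy norm, with a constant that depends only on the mesh and on the
Lamé constants. -/
theorem exists_abs_load_le (hΩo : IsOpen Ω) (hΩb : Bornology.IsBounded Ω) (M : Mesh Ω) {μ lam : ℝ}
    (hμ : 0 < μ) (hlam : 0 < lam) :
    ∃ C : ℝ, 0 ≤ C ∧ ∀ f : Plane → Fin 2 → ℝ,
      (∀ i, MemLp (fun x => f x i) 2 (volume.restrict Ω)) →
      ∀ φ : VB30 M, |load f φ| ≤ C * l2Norm Ω f * energyNorm μ lam φ := by
  let B := energyBilin μ lam (integrableOn_const_region (M := M) 1)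
  have hB : Function.Bijective B := by
    refine B.bijective_of_definite fun w hw => ?_
    have : 1 * energyNorm μ lam w ^ 2 = 0 := by rw [← energyForm_const]; exact hw
    exact eq_zero_of_energyNorm_eq_zero hΩo hμ hlam (by simpa using this)
  let b := Module.finBasis ℝ (VB30 M)
  -- the coordinates are represented by vectors for the energy scalar product
  choose r hr using fun i => hB.2 (b.coord i)
  let L : VB30 M → ℝ := fun φ =>
    Real.sqrt (∫ x in Ω, ∑ i, Broken.toFun (φ i).1 x ^ 2)
  have hn (w : VB30 M) : 0 ≤ energyNorm μ lam w := Real.sqrt_nonneg _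
  have hL (w : VB30 M) : 0 ≤ L w := Real.sqrt_nonneg _
  refine ⟨∑ i, energyNorm μ lam (r i) * L (b i),
    Finset.sum_nonneg fun i _ => mul_nonneg (hn _) (hL _), fun f hf φ => ?_⟩
  have h1 (ψ : VB30 M) : |load f ψ| ≤ l2Norm Ω f * L ψ :=
    abs_integral_sum_mul_le hf fun i => memLp_toFun hΩb (ψ i).1
  have h2 (i) : |b.repr φ i| ≤ energyNorm μ lam (r i) * energyNorm μ lam φ := by
    have : b.repr φ i = energyForm μ lam (fun _ => 1) (r i) φ := by
      rw [← b.coord_apply, ← hr, energyBilin_apply]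
    rw [this]
    exact abs_energyForm_one_le μ lam _ _
  have h3 : load f φ = ∑ i, b.repr φ i * load f (b i) := by
    change loadFunctional hΩb M hf φ = _
    conv_lhs => rw [← b.sum_repr φ]
    rw [map_sum]
    refine Finset.sum_congr rfl fun i _ => ?_
    rw [map_smul]
    rfl
  rw [h3, Finset.sum_mul, Finset.sum_mul]
  refine (Finset.abs_sum_le_sum_abs _ _).trans (Finset.sum_le_sum fun i _ => ?_)
  rw [abs_mul]
  refine (mul_le_mul (h2 i) (h1 (b i)) (abs_nonneg _) (mul_nonneg (hn _) (hn _))).trans_eq ?_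
  ring

end BiElastic

end

theorem mainTheorem3 (Ω : Set BiElastic.Plane) (hΩ_open : IsOpen Ω) (hΩ_convex : Convex ℝ Ω)
    (hΩ_bdd : Bornology.IsBounded Ω) (M : BiElastic.Mesh Ω)
    (μ lam : ℝ) (hμ : 0 < μ) (hlam : 0 < lam) :
    (∃ N : Seminorm ℝ (BiElastic.VB30 M),
      (∀ w, N w = BiElastic.energyNorm μ lam w) ∧ (∀ w, N w = 0 → w = 0)) ∧
    (∀ w : BiElastic.VB30 M,
      μ ^ 2 * BiElastic.laplaceNorm w ^ 2 ≤ BiElastic.energyNorm μ lam w ^ 2 ∧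
      μ ^ 2 * BiElastic.laplaceNorm w ^ 2 = μ ^ 2 * BiElastic.hessianNorm w ^ 2) ∧
    (∃ C : ℝ, 0 ≤ C ∧ ∀ (β : BiElastic.Plane → ℝ) (βmin βmax : ℝ),
      MeasureTheory.AEStronglyMeasurable β (MeasureTheory.volume.restrict Ω) →
      0 < βmin → (∀ x ∈ Ω, βmin ≤ β x ∧ β x ≤ βmax) →
      (∀ w : BiElastic.VB30 M,
        βmin * BiElastic.energyNorm μ lam w ^ 2 ≤ BiElastic.energyForm μ lam β w w) ∧
      (∀ w φ : BiElastic.VB30 M,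
        |BiElastic.energyForm μ lam β w φ| ≤
          βmax * BiElastic.energyNorm μ lam w * BiElastic.energyNorm μ lam φ) ∧
      (∀ f : BiElastic.Plane → Fin 2 → ℝ,
        (∀ i, MeasureTheory.MemLp (fun x => f x i) 2 (MeasureTheory.volume.restrict Ω)) →
        (∃! w : BiElastic.VB30 M, BiElastic.IsDiscreteSolution μ lam β f w) ∧
        (∀ w : BiElastic.VB30 M, BiElastic.IsDiscreteSolution μ lam β f w →
          BiElastic.energyNorm μ lam w ≤ C / βmin * BiElastic.l2Norm Ω f))) := by
  have hn (w : BiElastic.VB30 M) : 0 ≤ BiElastic.energyNorm μ lam w := Real.sqrt_nonneg _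
  have hdef (w : BiElastic.VB30 M) (h : BiElastic.energyNorm μ lam w = 0) : w = 0 :=
    BiElastic.eq_zero_of_energyNorm_eq_zero hΩ_open hμ hlam h
  refine ⟨⟨BiElastic.energySeminorm μ lam M, fun _ => rfl, hdef⟩, fun w =>
    ⟨BiElastic.laplaceNorm_sq_le hΩ_open hμ hlam w,
      by rw [BiElastic.hessianNorm_sq_eq hΩ_open]⟩, ?_⟩
  obtain ⟨C, hC0, hC⟩ := BiElastic.exists_abs_load_le hΩ_open hΩ_bdd M hμ hlam
  refine ⟨C, hC0, fun β βmin βmax hβm hmin hβ => ?_⟩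
  have hint := BiElastic.integrableOn_coefficient (M := M) hΩ_convex hΩ_open hβm hβ
  have hpos (T : M.triangles) : ∀ᵐ x ∂MeasureTheory.volume.restrict (BiElastic.region T.1), 0 ≤ β x :=
    BiElastic.ae_restrict_region hΩ_convex T fun x hx => hmin.le.trans (hβ x hx).1
  have hlow (w : BiElastic.VB30 M) :
      βmin * BiElastic.energyNorm μ lam w ^ 2 ≤ BiElastic.energyForm μ lam β w w := by
    rw [← BiElastic.energyForm_const]
    exact BiElastic.energyForm_mono μ lam (BiElastic.integrableOn_const_region βmin) hint
      (fun T => BiElastic.ae_restrict_region hΩ_convex T fun x hx => (hβ x hx).1) w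
  have hup (w : BiElastic.VB30 M) :
      BiElastic.energyForm μ lam β w w ≤ βmax * BiElastic.energyNorm μ lam w ^ 2 := by
    rw [← BiElastic.energyForm_const]
    exact BiElastic.energyForm_mono μ lam hint (BiElastic.integrableOn_const_region βmax)
      (fun T => BiElastic.ae_restrict_region hΩ_convex T fun x hx => (hβ x hx).2) w
  refine ⟨hlow, fun w φ => ?_, fun f hf => ⟨?_, fun w hw => ?_⟩⟩
  · -- `βmax` can be negative only if the energy norm vanishes
    have h1 : βmin * BiElastic.energyNorm μ lam w ^ 2 ≤ βmax * BiElastic.energyNorm μ lam w ^ 2 :=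
      (hlow w).trans (hup w)
    refine (BiElastic.abs_energyForm_le μ lam hint hpos w φ).trans ?_
    refine (mul_le_mul (Real.sqrt_le_sqrt (hup w)) (Real.sqrt_le_sqrt (hup φ))
      (Real.sqrt_nonneg _) (Real.sqrt_nonneg _)).trans_eq ?_
    rcases (hn w).eq_or_lt with h0 | h0
    · simp [← h0]
    · have hmax : 0 ≤ βmax := hmin.le.trans (le_of_mul_le_mul_right h1 (by positivity))
      rw [Real.sqrt_mul hmax, Real.sqrt_mul hmax, Real.sqrt_sq (hn w), Real.sqrt_sq (hn φ)]
      linear_combination (BiElastic.energyNorm μ lam w * BiElastic.energyNorm μ lam φ) *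
        Real.mul_self_sqrt hmax
  · -- the Riesz representation of the load
    have hbij := (BiElastic.energyBilin μ lam hint).bijective_of_definite fun w hw => hdef w <| by
      have h1 := hlow w
      rw [← BiElastic.energyBilin_apply μ lam hint, hw] at h1
      exact pow_eq_zero_iff two_ne_zero |>.1
        (le_antisymm (nonpos_of_mul_nonpos_right h1 hmin) (sq_nonneg _))
    obtain ⟨w, hw⟩ := hbij.2 (BiElastic.loadFunctional hΩ_bdd M hf)
    refine ⟨w, fun φ => LinearMap.congr_fun hw φ, fun w' hw' => hbij.1 ?_⟩
    rw [hw]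
    exact LinearMap.ext hw'
  · have h1 := (hlow w).trans_eq (hw w)
    have h2 := h1.trans ((le_abs_self _).trans (hC f hf w))
    rw [div_mul_eq_mul_div, le_div_iff₀ hmin]
    rcases (hn w).eq_or_lt with h0 | h0
    · rw [← h0, zero_mul]
      exact mul_nonneg hC0 (Real.sqrt_nonneg _)
    · refine le_of_mul_le_mul_right ?_ h0
      linarith
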